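/- **Theorem 1.2 (Bound on the GMRES relative residual).** Write $\|\cdot\|_2$ for the Euclidean norm on $\mathbb{C}^n$ and for the induced matrix norm. For a simple eigenvalue $\lambda$ of a matrix in $\mathbb{C}^{n\times n}$, with right eigenvector $u$ and left eigenvector $v$ ($v^*B=\lambda v^*$), let $\kappa(\lambda)=\|u\|_2\|v\|_2/|v^*u|$ be its condition number. Let $B\in\mathbb{C}^{n\times n}$ be nonsingular and diagonalisable with simple eigenvalues. Assume that all the eigenvalues of $B$ are contained in $\mathcal{N}\cup\mathcal{H}$, where $\mathcal{N}\subset\mathbb{C}$ is a bounded open set containing $0$ and $\mathcal{H}=\{z:\operatorname{Re} z\ge S\}$ for some $S>0$, and that $\mathcal{H}$ contains at least one eigenvalue of $B$ (so that $S\le\|B\|_2$). Let $\lambda_1,\dots,\lambda_\ell$ be the eigenvalues of $B$ in $\mathcal{N}$, and let $\kappa^*$ be the maximum of the condition numbers of the eigenvalues of $B$. Given $L_0,L_1$ with $0<L_0<L_1\le S$, let $$N_{\rm eig}=\big|\{j:\lambda_j\in\{L_0<\operatorname{Re} z<L_1\}\cap\mathcal{N}\}\big|+1,\qquad \delta=\frac{L_1-L_0}{4\,n\,\kappa^*N_{\rm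 eig}}.$$ Then there is a (necessarily unique) $\beta\in(0,\pi/2)$ with $$\cos\beta=\frac{L_0}{\|B\|_2+\delta},\qquad\text{and}\qquad \gamma_\beta:=2\sin\Big(\frac{\beta}{4-2\beta/\pi}\Big)<1 .$$ Let $b,x_0\in\mathbb{C}^n$ with $r_0:=b-Bx_0\ne0$ and let $m\ge0$ be an integer. Let $x_m$ be the $m$th GMRES iterate for $Bx=b$ started from $x_0$, i.e. the unique minimiser of $\|b-Bx\|_2$ over $x\in x_0+\operatorname{span}\{r_0,Br_0,\dots,B^{m-1}r_0\}$, and let $r_m:=b-Bx_m$. Then $$\frac{\|r_m\|_2}{\|r_0\|_2}\le\Big(\prod_{j=1}^{\ell}\frac1{|\lambda_j|}\Big)\,(\|B\|_2+\delta)^{\ell+1}\,3^{\ell+1}\,\delta^{-1}\,\gamma_\beta^{\,m-\ell}.$$ -/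

import Mathlib

/-- The operator on `ℂⁿ` (with the Euclidean norm) given by a matrix. Its operator norm
`‖euclOp B‖` is the matrix norm `‖B‖₂` induced by the Euclidean norm. -/
noncomputable abbrev euclOp {n : ℕ} (B : Matrix (Fin n) (Fin n) ℂ) :
    EuclideanSpace ℂ (Fin n) →L[ℂ] EuclideanSpace ℂ (Fin n) :=
  Matrix.toEuclideanCLM (n := Fin n) (𝕜 := ℂ) B

/-- The residual `b - B x` of a vector `x`. -/
noncomputable def linResidual {n : ℕ} (B : Matrix (Fin n) (Fin n) ℂ)
    (b x : EuclideanSpace ℂ (Fin n)) : EuclideanSpace ℂ (Fin n) :=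
  b - euclOp B x

/-- The Krylov space spanned by `r, B r, …, B ^ (m - 1) r`. -/
noncomputable def krylov {n : ℕ} (B : Matrix (Fin n) (Fin n) ℂ)
    (r : EuclideanSpace ℂ (Fin n)) (m : ℕ) : Submodule ℂ (EuclideanSpace ℂ (Fin n)) :=
  Submodule.span ℂ (Set.range fun j : Fin m => euclOp (B ^ (j : ℕ)) r)

/-- `x` is the `m`-th GMRES iterate for `B x = b` with starting vector `x₀`: it lies in
`x₀ + krylov B r₀ m`, with `r₀ = b - B x₀`, and minimises the Euclidean norm of the residual
over that affine space. -/
def IsGMRESIterate {n : ℕ} (B : Matrix (Fin n) (Fin n) ℂ)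
    (b x₀ : EuclideanSpace ℂ (Fin n)) (m : ℕ) (x : EuclideanSpace ℂ (Fin n)) : Prop :=
  x - x₀ ∈ krylov B (linResidual B b x₀) m ∧
    ∀ y : EuclideanSpace ℂ (Fin n), y - x₀ ∈ krylov B (linResidual B b x₀) m →
      ‖linResidual B b x‖ ≤ ‖linResidual B b y‖

/-- For a nonsingular matrix the `m`-th GMRES iterate exists and is unique. -/
theorem existsUnique_isGMRESIterate {n : ℕ} (B : Matrix (Fin n) (Fin n) ℂ) (hB : IsUnit B)
    (b x₀ : EuclideanSpace ℂ (Fin n)) (m : ℕ) :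
    ∃! x : EuclideanSpace ℂ (Fin n), IsGMRESIterate B b x₀ m x := by
  have hinj : Function.Injective (euclOp B) := by
    obtain ⟨C, hC⟩ := (hB.map (Matrix.toEuclideanCLM (n := Fin n) (𝕜 := ℂ))).exists_left_inv
    intro x y hxy
    have hx : ∀ z, C (euclOp B z) = z := fun z => congrArg (fun T => T z) hC
    rw [← hx x, ← hx y, hxy]
  set r := linResidual B b x₀ with hr
  set K := krylov B r m with hK
  set W := K.map (euclOp B).toLinearMap with hW
  have hres : ∀ y, linResidual B b y = r - euclOp B (y - x₀) := by
    intro y; simp [hr, linResidual]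
  have hdecomp : ∀ z ∈ K, ‖r - euclOp B z‖ * ‖r - euclOp B z‖ =
      ‖r - W.starProjection r‖ * ‖r - W.starProjection r‖ +
        ‖W.starProjection r - euclOp B z‖ * ‖W.starProjection r - euclOp B z‖ := by
    intro z hz
    have hw : euclOp B z ∈ W := Submodule.mem_map_of_mem hz
    have h0 : inner ℂ (r - W.starProjection r) (W.starProjection r - euclOp B z) = 0 :=
      W.starProjection_inner_eq_zero r _
        (W.sub_mem (W.starProjection_apply_mem r) hw)
    have := norm_add_sq_eq_norm_sq_add_norm_sq_of_inner_eq_zero _ _ h0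
    simpa using this
  obtain ⟨k, hkK, hk⟩ := W.starProjection_apply_mem r
  have hk' : euclOp B k = W.starProjection r := hk
  refine ⟨x₀ + k, ⟨by simpa using hkK, ?_⟩, ?_⟩
  · intro y hy
    have := hdecomp _ hy
    rw [hres, hres, add_sub_cancel_left, hk']
    nlinarith [norm_nonneg (r - W.starProjection r), norm_nonneg (r - euclOp B (y - x₀)),
      mul_self_nonneg ‖W.starProjection r - euclOp B (y - x₀)‖]
  · rintro y ⟨hy, hmin⟩
    have h1 := hdecomp _ hy
    have h2 := hmin (x₀ + k) (by simpa using hkK)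
    rw [hres, hres, add_sub_cancel_left, hk'] at h2
    have h3 : ‖W.starProjection r - euclOp B (y - x₀)‖ = 0 := by
      have := mul_self_le_mul_self (norm_nonneg _) h2
      exact mul_self_eq_zero.mp (le_antisymm (by linarith) (mul_self_nonneg _))
    rw [norm_eq_zero, sub_eq_zero, ← hk'] at h3
    rw [hinj h3]
    simp

/-- The condition number `κ(μ) = ‖u‖ ‖v‖ / |v* u|` of an eigenvalue `μ`, where `u` is a right
eigenvector (`B u = μ u`) and `v` a left eigenvector (`v* B = μ v*`). For a simple eigenvalue
the set on the right has exactly one element, as both eigenspaces are lines and the quotient does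
not change when `u` and `v` are rescaled. -/
noncomputable def eigenvalueCond {n : ℕ} (B : Matrix (Fin n) (Fin n) ℂ) (μ : ℂ) : ℝ :=
  sSup {κ : ℝ | ∃ u v : EuclideanSpace ℂ (Fin n), u ≠ 0 ∧ v ≠ 0 ∧
    Matrix.mulVec B u.ofLp = μ • u.ofLp ∧
    Matrix.vecMul (star v.ofLp) B = μ • star v.ofLp ∧
    κ = ‖u‖ * ‖v‖ / ‖inner ℂ v u‖}

/-- The maximum of the condition numbers of the (finitely many) eigenvalues of `B`. -/
noncomputable def maxEigenvalueCond {n : ℕ} (B : Matrix (Fin n) (Fin n) ℂ) : ℝ :=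
  ⨆ μ : spectrum ℂ B, eigenvalueCond B μ

/-- `γ_β = 2 sin (β / (4 - 2 β / π))`. -/
noncomputable def gammaRate (β : ℝ) : ℝ :=
  2 * Real.sin (β / (4 - 2 * β / Real.pi))

/-! The GMRES residual is at most `‖p(B) r₀‖` for every polynomial `p` of degree at most `m` with
`p(0) = 1` (`IsGMRESIterate.norm_residual_le`). Simple eigenvalues give `p(B) x = ∑ p(μᵢ) ⟨wᵢ, x⟩
uᵢ`, and `‖uᵢ‖ ‖wᵢ‖` is the condition number of `μᵢ` when `⟨wᵢ, uᵢ⟩ = 1`; hence `‖p(B)‖ ≤ n κ* max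
|p(μᵢ)|` (`IsEigensystem.norm_aeval_le`). It remains to find `p` small on the spectrum.

Take `p = d q`. The factor `d = ∏ (1 - X / λⱼ)` kills the eigenvalues in `N`. With `R = ‖B‖ + δ`,
all others satisfy `|z| < R` and `Re z ≥ S > L₀ = R cos β`, so they lie in `R` times the circular
segment `|z| < 1`, `Re z > cos β`. There `|d| ≤ ∏ 2R / |λⱼ|`, and `q` is a rescaled Faber polynomial
of the segment, divided by its value at `0`.

The Faber polynomial `F` of degree `n` belongs to an exterior map `ψ` from the unit disc, with pole
at `0`: `F(ψ(ζ)) = ζ⁻ⁿ + O(ζ)`. For `z` in the segment, `F(z)` is the `n`th Taylor coefficient of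
`-ζ ψ' / (ψ - z)`, which equals `1` at `0`. The segment is convex, so this function has nonnegative
real part on the circle, and Carathéodory's bound gives `|F| ≤ 2`. By the maximum principle `F(ψ(ζ))
- ζ⁻ⁿ` is at most `3` in the disc. An explicit `ψ`, built from powers of linear functions, satisfies
`ψ(-γ_β) = 0`; hence `|F(0)| ≥ γ_β⁻ⁿ - 3`. -/

/-! ### Faber polynomials of a domain given by its exterior map. -/

open Complex Metric Set MeasureTheory in
/-- Carathéodory's coefficient bound on the closed unit disc. -/
theorem norm_circleIntegral_zpow_mul_le_of_re_nonneg {f : ℂ → ℂ}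
    (hf : DiffContOnCl ℂ f (ball 0 1)) (hre : ∀ ζ ∈ sphere (0 : ℂ) 1, 0 ≤ (f ζ).re)
    {n : ℕ} (hn : n ≠ 0) :
    ‖∮ ζ in C(0, 1), (ζ ^ (n + 1))⁻¹ * f ζ‖ ≤ 4 * Real.pi * (f 0).re := by
  have hcont : ContinuousOn f (closedBall 0 1) := by
    simpa [closure_ball (0 : ℂ) one_ne_zero] using hf.continuousOn
  have hmap : ∀ θ : ℝ, circleMap 0 1 θ ∈ sphere (0 : ℂ) 1 := fun θ =>
    circleMap_mem_sphere 0 zero_le_one θ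
  have hne : ∀ θ : ℝ, circleMap 0 1 θ ≠ 0 := fun θ => circleMap_ne_center one_ne_zero
  have hfc : Continuous fun θ : ℝ => f (circleMap 0 1 θ) :=
    hcont.comp_continuous (continuous_circleMap 0 1) fun θ => sphere_subset_closedBall (hmap θ)
  have hconj : ∀ θ : ℝ, (starRingEnd ℂ) (circleMap 0 1 θ) = (circleMap 0 1 θ)⁻¹ := by
    intro θ
    rw [Complex.inv_def, Complex.normSq_eq_norm_sq]
    have := hmap θ
    simp at this
    simp
  obtain ⟨k, rfl⟩ := Nat.exists_eq_succ_of_ne_zero hn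
  have h0 : ∮ ζ in C(0, 1), ζ ^ k * f ζ = 0 := by
    have hd : DiffContOnCl ℂ (fun ζ => ζ ^ k * f ζ) (ball 0 1) :=
      (((differentiable_id.pow k).diffContOnCl).smul hf)
    exact hd.circleIntegral_eq_zero zero_le_one
  have h1 : ∮ ζ in C(0, 1), ζ⁻¹ * f ζ = 2 * Real.pi * I * f 0 := by
    have := hf.circleIntegral_sub_inv_smul (w := 0) (by simp)
    simpa using this
  have h0' : ∫ θ in (0 : ℝ)..2 * Real.pi, (circleMap 0 1 θ) ^ (k + 1) * f (circleMap 0 1 θ) = 0 := by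
    rw [circleIntegral] at h0
    have : ∀ θ : ℝ, deriv (circleMap 0 1) θ • (circleMap 0 1 θ ^ k * f (circleMap 0 1 θ)) =
        I * ((circleMap 0 1 θ) ^ (k + 1) * f (circleMap 0 1 θ)) := by
      intro θ; simp [deriv_circleMap]; ring
    simp_rw [this] at h0
    rw [intervalIntegral.integral_const_mul] at h0
    simpa using h0
  have h1' : ∫ θ in (0 : ℝ)..2 * Real.pi, f (circleMap 0 1 θ) = 2 * Real.pi * f 0 := by
    rw [circleIntegral] at h1
    have : ∀ θ : ℝ, deriv (circleMap 0 1) θ • ((circleMap 0 1 θ)⁻¹ * f (circleMap 0 1 θ)) =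
        I * f (circleMap 0 1 θ) := by
      intro θ
      have := hne θ
      simp only [deriv_circleMap, smul_eq_mul]
      field_simp
    simp_rw [this] at h1
    rw [intervalIntegral.integral_const_mul] at h1
    have h2 : I * (∫ θ in (0 : ℝ)..2 * Real.pi, f (circleMap 0 1 θ)) = I * (2 * Real.pi * f 0) := by
      rw [h1]; ring
    exact mul_left_cancel₀ I_ne_zero h2
  -- On the unit circle conjugation is inversion, so this is the conjugate of the vanishing integral
  -- `h0'`.
  have h0'' : ∫ θ in (0 : ℝ)..2 * Real.pi,
      ((circleMap 0 1 θ) ^ (k + 1))⁻¹ * (starRingEnd ℂ) (f (circleMap 0 1 θ)) = 0 := by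
    have : ∀ θ : ℝ, ((circleMap 0 1 θ) ^ (k + 1))⁻¹ * (starRingEnd ℂ) (f (circleMap 0 1 θ)) =
        (starRingEnd ℂ) ((circleMap 0 1 θ) ^ (k + 1) * f (circleMap 0 1 θ)) := by
      intro θ; rw [map_mul, map_pow, hconj, inv_pow]
    simp_rw [this]
    rw [intervalIntegral.intervalIntegral_eq_integral_uIoc, integral_conj]
    rw [intervalIntegral.intervalIntegral_eq_integral_uIoc] at h0'
    rw [if_pos (by positivity)] at h0' ⊢
    simp only [one_smul] at h0' ⊢
    rw [h0', map_zero]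
  have hpc : Continuous fun θ : ℝ => ((circleMap 0 1 θ) ^ (k + 1))⁻¹ :=
    ((continuous_circleMap 0 1).pow _).inv₀ fun θ => pow_ne_zero _ (hne θ)
  -- Adding the vanishing conjugate integral replaces `f` by `2 Re f`, whose absolute value is
  -- itself and integrates to `4π Re f(0)`.
  have hsum : ∮ ζ in C(0, 1), (ζ ^ (k + 1 + 1))⁻¹ * f ζ =
      I * ∫ θ in (0 : ℝ)..2 * Real.pi,
        ((circleMap 0 1 θ) ^ (k + 1))⁻¹ * ((2 * (f (circleMap 0 1 θ)).re : ℝ) : ℂ) := by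
    have e1 : ∀ θ : ℝ, ((circleMap 0 1 θ) ^ (k + 1))⁻¹ * ((2 * (f (circleMap 0 1 θ)).re : ℝ) : ℂ) =
        ((circleMap 0 1 θ) ^ (k + 1))⁻¹ * f (circleMap 0 1 θ) +
        ((circleMap 0 1 θ) ^ (k + 1))⁻¹ * (starRingEnd ℂ) (f (circleMap 0 1 θ)) := by
      intro θ; rw [← mul_add, Complex.add_conj]
    simp_rw [e1]
    have i1 : IntervalIntegrable
        (fun θ => ((circleMap 0 1 θ) ^ (k + 1))⁻¹ * f (circleMap 0 1 θ))
        volume 0 (2 * Real.pi) := (hpc.mul hfc).intervalIntegrable _ _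
    have i2 : IntervalIntegrable
        (fun θ => ((circleMap 0 1 θ) ^ (k + 1))⁻¹ * (starRingEnd ℂ) (f (circleMap 0 1 θ)))
        volume 0 (2 * Real.pi) :=
      (hpc.mul (Complex.continuous_conj.comp hfc)).intervalIntegrable _ _
    rw [intervalIntegral.integral_add i1 i2, h0'', add_zero,
      ← intervalIntegral.integral_const_mul, circleIntegral]
    congr 1
    ext θ
    have := hne θ
    simp only [deriv_circleMap, smul_eq_mul]
    field_simp
    ring
  rw [hsum, norm_mul, norm_I, one_mul]
  refine (intervalIntegral.norm_integral_le_integral_norm (by positivity)).trans ?_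
  have e2 : ∀ θ : ℝ, ‖((circleMap 0 1 θ) ^ (k + 1))⁻¹ * ((2 * (f (circleMap 0 1 θ)).re : ℝ) : ℂ)‖ =
      2 * (f (circleMap 0 1 θ)).re := by
    intro θ
    have h2 := hmap θ
    have h3 := hre _ h2
    rw [mem_sphere_zero_iff_norm] at h2
    rw [norm_mul, norm_inv, norm_pow, h2, one_pow, inv_one, one_mul, Complex.norm_real,
      Real.norm_of_nonneg (by linarith)]
  simp_rw [e2]
  rw [intervalIntegral.integral_const_mul]
  have e3 : ∫ θ in (0 : ℝ)..2 * Real.pi, (f (circleMap 0 1 θ)).re = (2 * Real.pi * f 0).re := by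
    rw [← h1']
    exact Complex.reCLM.intervalIntegral_comp_comm (hfc.intervalIntegrable _ _)
  rw [e3]
  have : (2 * (Real.pi : ℂ) * f 0).re = 2 * Real.pi * (f 0).re := by
    rw [show (2 * (Real.pi : ℂ)) = ((2 * Real.pi : ℝ) : ℂ) by push_cast; rfl, Complex.re_ofReal_mul]
  rw [this]
  linarith

open Complex Metric Set in
theorem DiffContOnCl.dslope_zero {f : ℂ → ℂ} (hf : DiffContOnCl ℂ f (ball 0 1)) :
    DiffContOnCl ℂ (dslope f 0) (ball 0 1) := by
  have hb : ball (0 : ℂ) 1 ∈ nhds (0 : ℂ) := ball_mem_nhds _ one_pos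
  refine ⟨(Complex.differentiableOn_dslope hb).2 hf.differentiableOn, ?_⟩
  exact (continuousOn_dslope (Filter.mem_of_superset hb subset_closure)).2
    ⟨hf.continuousOn, hf.differentiableOn.differentiableAt hb⟩

theorem mul_dslope_zero (f : ℂ → ℂ) (ζ : ℂ) : ζ * dslope f 0 ζ = f ζ - f 0 := by
  simpa using sub_smul_dslope f 0 ζ

open Complex Metric Set Polynomial in
/-- Every principal part `g ζ / ζ ^ n` is matched by a polynomial in `χ ζ / ζ`. -/
theorem exists_polynomial_eval_div_eq {χ : ℂ → ℂ} (hχ : DiffContOnCl ℂ χ (ball 0 1))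
    (h0 : χ 0 ≠ 0) (n : ℕ) : ∀ g : ℂ → ℂ, DiffContOnCl ℂ g (ball 0 1) →
    ∃ p : ℂ[X], p.natDegree ≤ n ∧ ∃ k : ℂ → ℂ, DiffContOnCl ℂ k (ball 0 1) ∧
      ∀ ζ : ℂ, ζ ≠ 0 → p.eval (χ ζ / ζ) = g ζ / ζ ^ n + k ζ := by
  induction n with
  | zero =>
    intro g hg
    exact ⟨0, by simp, fun ζ => -g ζ, hg.neg, fun ζ _ => by simp⟩
  | succ n ih =>
    intro g hg
    -- This `c` makes `g - c χ ^ (n + 1)` vanish at `0`; dividing by `ζ` then lowers the order of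
    -- the pole by one.
    set c := g 0 / χ 0 ^ (n + 1) with hc
    have hpow : ∀ j : ℕ, DiffContOnCl ℂ (fun ζ => χ ζ ^ j) (ball 0 1) := by
      intro j
      induction j with
      | zero => simpa using diffContOnCl_const
      | succ j hj => simpa only [pow_succ, smul_eq_mul] using hj.smul hχ
    have hf : DiffContOnCl ℂ (fun ζ => g ζ - c * χ ζ ^ (n + 1)) (ball 0 1) :=
      hg.sub ((hpow (n + 1)).const_smul c)
    obtain ⟨p, hp, k, hk, hpk⟩ := ih _ hf.dslope_zero
    refine ⟨p + C c * X ^ (n + 1), ?_, k, hk, ?_⟩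
    · refine (natDegree_add_le _ _).trans (max_le (by omega) ?_)
      exact natDegree_C_mul_X_pow_le _ _
    · intro ζ hζ
      have h1 := mul_dslope_zero (fun ζ => g ζ - c * χ ζ ^ (n + 1)) ζ
      have h2 : g 0 - c * χ 0 ^ (n + 1) = 0 := by rw [hc]; field_simp; simp
      simp only [h2, sub_zero] at h1
      simp only [eval_add, eval_mul, eval_C, eval_pow, eval_X, hpk ζ hζ]
      have h3 : g ζ = ζ * dslope (fun ζ => g ζ - c * χ ζ ^ (n + 1)) 0 ζ + c * χ ζ ^ (n + 1) := by
        rw [h1]; ring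
      generalize dslope (fun ζ => g ζ - c * χ ζ ^ (n + 1)) 0 ζ = t at h3 ⊢
      rw [h3, div_pow]
      field_simp
      ring

open Polynomial in
theorem Polynomial.exists_derivative_eq (q : ℂ[X]) : ∃ r : ℂ[X], derivative r = q := by
  induction q using Polynomial.induction_on' with
  | add p q hp hq =>
    obtain ⟨r, rfl⟩ := hp
    obtain ⟨s, rfl⟩ := hq
    exact ⟨r + s, derivative_add⟩
  | monomial n a =>
    refine ⟨monomial (n + 1) (a / (n + 1)), ?_⟩
    rw [derivative_monomial]
    have : (n : ℂ) + 1 ≠ 0 := by exact_mod_cast n.succ_ne_zero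
    simp [this]

open Complex Metric Set Polynomial in
/-- Let `ψ = χ ζ / ζ` and let `p` be the Faber polynomial with `p (ψ ζ) = ζ ^ (-n) + O(ζ)`. Then
`p` is bounded by `2` wherever `-ζ ψ' / (ψ - z)` has nonnegative real part on the circle. -/
theorem norm_eval_le_two_of_re_nonneg {χ M k : ℂ → ℂ} (hχ : DiffContOnCl ℂ χ (ball 0 1))
    (hM : DiffContOnCl ℂ M (ball 0 1)) (hk : DiffContOnCl ℂ k (ball 0 1)) (h0 : χ 0 ≠ 0)
    (hM0 : M 0 = χ 0) (hk0 : k 0 = 0)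
    (hderiv : ∀ ζ ∈ ball (0 : ℂ) 1, ζ ≠ 0 →
      HasDerivAt (fun ζ => χ ζ / ζ) (-(M ζ / ζ ^ 2)) ζ)
    {n : ℕ} (hn : n ≠ 0) {p : ℂ[X]}
    (hp : ∀ ζ ∈ ball (0 : ℂ) 1, ζ ≠ 0 → p.eval (χ ζ / ζ) = (ζ ^ n)⁻¹ + k ζ)
    {z : ℂ} (hz : ∀ ζ ∈ closedBall (0 : ℂ) 1, χ ζ - z * ζ ≠ 0)
    (hre : ∀ ζ ∈ sphere (0 : ℂ) 1, 0 ≤ (M ζ / (χ ζ - z * ζ)).re) :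
    ‖p.eval z‖ ≤ 2 := by
  set K : ℂ → ℂ := fun ζ => M ζ / (χ ζ - z * ζ) with hK
  have hcl : closure (ball (0 : ℂ) 1) = closedBall 0 1 := closure_ball _ one_ne_zero
  have hKd : DiffContOnCl ℂ K (ball 0 1) := by
    have h1 : DiffContOnCl ℂ (fun ζ => χ ζ - z * ζ) (ball 0 1) :=
      hχ.sub ((differentiable_id.diffContOnCl).const_smul z)
    have h2 := h1.inv (fun ζ hζ => hz ζ (hcl ▸ hζ))
    simpa [hK, div_eq_mul_inv] using hM.smul h2
  have hK0 : K 0 = 1 := by simp [hK, hM0, h0]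
  have hhalf : closedBall (0 : ℂ) (1 / 2) ⊆ ball 0 1 := closedBall_subset_ball (by norm_num)
  have hsub : ball (0 : ℂ) (1 / 2) ⊆ ball 0 1 := ball_subset_ball (by norm_num)
  have hsph : ∀ ζ ∈ sphere (0 : ℂ) (1 / 2), ζ ∈ ball (0 : ℂ) 1 ∧ ζ ≠ 0 := fun ζ hζ =>
    ⟨hhalf (sphere_subset_closedBall hζ), ne_of_mem_sphere hζ (by norm_num)⟩
  -- With `ψ = χ / ζ` and `R' = (p - p(z)) / (X - z)`, the integrand of `e1` is the derivative of
  -- `-R ∘ ψ`, so its integral over a closed curve is zero.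
  obtain ⟨R, hR⟩ := Polynomial.exists_derivative_eq (p /ₘ (X - C z))
  have hdiv : ∀ y, p.eval y - p.eval z = (y - z) * (derivative R).eval y := by
    intro y
    rw [hR]
    have := congrArg (eval y) (modByMonic_add_div p (X - C z))
    rw [modByMonic_X_sub_C_eq_C_eval] at this
    simp at this
    rw [← this]; ring
  have e1 : ∮ ζ in C(0, 1 / 2), (p.eval (χ ζ / ζ) - p.eval z) * (ζ⁻¹ * K ζ) = 0 := by
    refine circleIntegral.integral_eq_zero_of_hasDerivWithinAt
      (f := fun ζ => -(R.eval (χ ζ / ζ))) (by norm_num) fun ζ hζ => ?_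
    obtain ⟨hζ1, hζ0⟩ := hsph ζ hζ
    have h2 := (HasDerivAt.comp (h := fun ζ => χ ζ / ζ) ζ (R.hasDerivAt (χ ζ / ζ))
      (hderiv ζ hζ1 hζ0)).neg
    refine (HasDerivAt.congr_deriv h2 ?_).hasDerivWithinAt
    have h3 : χ ζ - ζ * z ≠ 0 := mul_comm z ζ ▸ hz ζ (ball_subset_closedBall hζ1)
    rw [hdiv, hK]
    field_simp
  have hKc : ContinuousOn K (sphere 0 (1 / 2)) := hKd.continuousOn.mono fun ζ hζ =>
    subset_closure (hsph ζ hζ).1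
  have hkc : ContinuousOn k (sphere 0 (1 / 2)) := hk.continuousOn.mono fun ζ hζ =>
    subset_closure (hsph ζ hζ).1
  have hic : ContinuousOn (fun ζ : ℂ => ζ⁻¹) (sphere 0 (1 / 2)) :=
    continuousOn_id.inv₀ fun ζ hζ => (hsph ζ hζ).2
  have cauchy : ∀ f : ℂ → ℂ, DiffContOnCl ℂ f (ball 0 1) →
      ∮ ζ in C(0, 1 / 2), ζ⁻¹ * f ζ = 2 * Real.pi * I * f 0 := by
    intro f hf
    have hf' : DiffContOnCl ℂ f (ball 0 (1 / 2)) := hf.mono hsub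
    have := hf'.circleIntegral_sub_inv_smul (w := 0) (by simp)
    simpa using this
  have e2 : ∮ ζ in C(0, 1 / 2), ζ⁻¹ * K ζ = 2 * Real.pi * I := by
    rw [cauchy K hKd, hK0, mul_one]
  have e3 : ∮ ζ in C(0, 1 / 2), ζ⁻¹ * (k ζ * K ζ) = 0 := by
    rw [cauchy (fun ζ => k ζ * K ζ) (hk.smul hKd), hk0]; ring
  -- Inserting `p(ψ) = ζ⁻ⁿ + k` in `e1` identifies `p(z)` as the `n`th Taylor coefficient of `K`;
  -- `k` contributes nothing because `k(0) = 0`.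
  have e4 : ∮ ζ in C(0, 1 / 2), (ζ ^ (n + 1))⁻¹ * K ζ = 2 * Real.pi * I * p.eval z := by
    have hcongr : ∮ ζ in C(0, 1 / 2), (p.eval (χ ζ / ζ) - p.eval z) * (ζ⁻¹ * K ζ) =
        ∮ ζ in C(0, 1 / 2), ((ζ ^ (n + 1))⁻¹ * K ζ + ζ⁻¹ * (k ζ * K ζ) -
          p.eval z * (ζ⁻¹ * K ζ)) := by
      refine circleIntegral.integral_congr (by norm_num) fun ζ hζ => ?_
      obtain ⟨hζ1, hζ0⟩ := hsph ζ hζ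
      simp only [hp ζ hζ1 hζ0]
      field_simp
      ring
    have i1 : CircleIntegrable (fun ζ => (ζ ^ (n + 1))⁻¹ * K ζ) 0 (1 / 2) := by
      refine ContinuousOn.circleIntegrable (by norm_num) (ContinuousOn.mul ?_ hKc)
      exact (continuousOn_id.pow _).inv₀ fun ζ hζ => pow_ne_zero _ (hsph ζ hζ).2
    have i2 : CircleIntegrable (fun ζ => ζ⁻¹ * (k ζ * K ζ)) 0 (1 / 2) :=
      ContinuousOn.circleIntegrable (by norm_num) (hic.mul (hkc.mul hKc))
    have i3 : CircleIntegrable (fun ζ => p.eval z * (ζ⁻¹ * K ζ)) 0 (1 / 2) :=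
      ContinuousOn.circleIntegrable (by norm_num) (continuousOn_const.mul (hic.mul hKc))
    have i12 : CircleIntegrable (fun ζ => (ζ ^ (n + 1))⁻¹ * K ζ + ζ⁻¹ * (k ζ * K ζ)) 0 (1 / 2) :=
      i1.add i2
    rw [hcongr, circleIntegral.integral_sub i12 i3, circleIntegral.integral_add i1 i2, e3,
      circleIntegral.integral_const_mul, e2, add_zero] at e1
    rw [sub_eq_zero.mp e1]; ring
  -- The exactness argument needs `ψ'`, known only inside the disc, whereas the sign of `Re K` is
  -- known on the unit circle.
  have e5 : ∮ ζ in C(0, 1), (ζ ^ (n + 1))⁻¹ * K ζ = ∮ ζ in C(0, 1 / 2), (ζ ^ (n + 1))⁻¹ * K ζ := by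
    refine Complex.circleIntegral_eq_of_differentiable_on_annulus_off_countable
      (by norm_num) (by norm_num) countable_empty ?_ ?_
    · refine ContinuousOn.mul ?_ (hKd.continuousOn.mono ?_)
      · refine (continuousOn_id.pow _).inv₀ fun ζ hζ => pow_ne_zero _ ?_
        rintro rfl
        exact hζ.2 (by simp)
      · rw [hcl]; exact sdiff_subset
    · intro ζ hζ
      have h1 : ζ ∈ ball (0 : ℂ) 1 := hζ.1.1
      have h2 : ζ ≠ 0 := by
        rintro rfl
        exact hζ.1.2 (by simp)
      exact ((differentiableAt_id.pow _).inv (pow_ne_zero _ h2)).mul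
        (hKd.differentiableAt isOpen_ball h1)
  have h := norm_circleIntegral_zpow_mul_le_of_re_nonneg hKd hre hn
  rw [e5, e4, hK0, norm_mul, norm_mul, norm_mul, norm_I, Complex.norm_real,
    Real.norm_of_nonneg Real.pi_pos.le] at h
  simp at h
  nlinarith [Real.pi_pos]

open Complex Metric Set Polynomial in
/-- Faber polynomials of a domain with exterior map `ζ ↦ χ ζ / ζ`. -/
theorem exists_faber_polynomial {χ M : ℂ → ℂ} {Z : Set ℂ} (hχ : DiffContOnCl ℂ χ (ball 0 1))
    (hM : DiffContOnCl ℂ M (ball 0 1)) (h0 : χ 0 ≠ 0) (hM0 : M 0 = χ 0)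
    (hderiv : ∀ ζ ∈ ball (0 : ℂ) 1, ζ ≠ 0 →
      HasDerivAt (fun ζ => χ ζ / ζ) (-(M ζ / ζ ^ 2)) ζ)
    (hz : ∀ z ∈ Z, ∀ ζ ∈ closedBall (0 : ℂ) 1, χ ζ - z * ζ ≠ 0)
    (hre : ∀ z ∈ Z, ∀ ζ ∈ sphere (0 : ℂ) 1, 0 ≤ (M ζ / (χ ζ - z * ζ)).re)
    (hbd : ∀ ζ ∈ sphere (0 : ℂ) 1, χ ζ / ζ ∈ closure Z)
    {n : ℕ} (hn : n ≠ 0) {ζ₀ : ℂ} (hζ₀ : ζ₀ ∈ ball (0 : ℂ) 1) (hne : ζ₀ ≠ 0) (hχ₀ : χ ζ₀ = 0) :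
    ∃ p : ℂ[X], p.natDegree ≤ n ∧ (∀ z ∈ Z, ‖p.eval z‖ ≤ 2) ∧
      (‖ζ₀‖ ^ n)⁻¹ - 3 ≤ ‖p.eval 0‖ := by
  obtain ⟨p, hpn, k, hk, hpk⟩ := exists_polynomial_eval_div_eq hχ h0 n (fun _ => 1)
    diffContOnCl_const
  set q := p - C (k 0) with hq
  set j : ℂ → ℂ := fun ζ => k ζ - k 0 with hj
  have hjd : DiffContOnCl ℂ j (ball 0 1) := hk.sub diffContOnCl_const
  have hqj : ∀ ζ : ℂ, ζ ≠ 0 → q.eval (χ ζ / ζ) = (ζ ^ n)⁻¹ + j ζ := by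
    intro ζ hζ
    simp [hq, hj, hpk ζ hζ]; ring
  have hqn : q.natDegree ≤ n := (natDegree_sub_C (p := p) (a := k 0)).le.trans hpn
  have h2 : ∀ z ∈ Z, ‖q.eval z‖ ≤ 2 := fun z hzZ =>
    norm_eval_le_two_of_re_nonneg hχ hM hjd h0 hM0 (by simp [hj]) hderiv hn
      (fun ζ _ hζ => hqj ζ hζ) (hz z hzZ) (hre z hzZ)
  have h2' : ∀ z ∈ closure Z, ‖q.eval z‖ ≤ 2 := fun z hzZ =>
    closure_minimal (s := Z) (t := {z | ‖q.eval z‖ ≤ 2}) h2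
      (isClosed_le (q.continuous.norm) continuous_const) hzZ
  -- Maximum principle: on the unit circle `j = q(ψ) - ζ⁻ⁿ`, bounded by `2 + 1`.
  have h3 : ‖j ζ₀‖ ≤ 3 := by
    refine Complex.norm_le_of_forall_mem_frontier_norm_le isBounded_ball hjd ?_
      (subset_closure hζ₀)
    intro ζ hζ
    rw [frontier_ball (0 : ℂ) one_ne_zero] at hζ
    have hζ0 : ζ ≠ 0 := ne_of_mem_sphere hζ one_ne_zero
    have h4 := h2' _ (hbd ζ hζ)
    have h5 : j ζ = q.eval (χ ζ / ζ) - (ζ ^ n)⁻¹ := by rw [hqj ζ hζ0]; ring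
    rw [mem_sphere_zero_iff_norm] at hζ
    rw [h5]
    refine (norm_sub_le _ _).trans ?_
    rw [norm_inv, norm_pow, hζ, one_pow, inv_one]
    linarith
  refine ⟨q, hqn, h2, ?_⟩
  have h6 := hqj ζ₀ hne
  rw [hχ₀, zero_div] at h6
  rw [h6]
  have h7 := norm_sub_norm_le ((ζ₀ ^ n)⁻¹) (-j ζ₀)
  rw [norm_neg, sub_neg_eq_add, norm_inv, norm_pow] at h7
  linarith

/-! ### Points of the unit circle and the inscribed angle. -/

/-- The point `exp (i t)` of the unit circle. -/
noncomputable def cis (t : ℝ) : ℂ := Complex.exp (t * Complex.I)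

theorem cis_re (t : ℝ) : (cis t).re = Real.cos t := Complex.exp_ofReal_mul_I_re t

theorem cis_im (t : ℝ) : (cis t).im = Real.sin t := Complex.exp_ofReal_mul_I_im t

theorem norm_cis (t : ℝ) : ‖cis t‖ = 1 := Complex.norm_exp_ofReal_mul_I t

theorem cis_ne_zero (t : ℝ) : cis t ≠ 0 := Complex.exp_ne_zero _

theorem cis_add (s t : ℝ) : cis (s + t) = cis s * cis t := by
  simp [cis, add_mul, Complex.exp_add]

theorem cis_zero : cis 0 = 1 := by simp [cis]

theorem cis_mul_cis_neg (t : ℝ) : cis t * cis (-t) = 1 := by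
  rw [← cis_add, add_neg_cancel, cis_zero]

theorem conj_cis (t : ℝ) : (starRingEnd ℂ) (cis t) = cis (-t) := by
  apply Complex.ext <;> simp [cis_re, cis_im]

theorem cis_sub_cis_neg (t : ℝ) : cis t - cis (-t) = 2 * Real.sin t * Complex.I := by
  apply Complex.ext <;> simp [cis_re, cis_im, -Complex.ofReal_sin]
  ring

theorem cis_add_cis_neg (t : ℝ) : cis t + cis (-t) = (2 * Real.cos t : ℝ) := by
  apply Complex.ext <;> simp [cis_re, cis_im, -Complex.ofReal_cos]
  ring

theorem cis_ne_cis_neg {t : ℝ} (ht : t ∈ Set.Ioo 0 Real.pi) : cis t ≠ cis (-t) := by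
  intro h
  have h1 := congrArg Complex.im h
  have h2 := Real.sin_pos_of_mem_Ioo ht
  rw [cis_im, cis_im, Real.sin_neg] at h1
  linarith

theorem one_sub_cis_mul_re_nonneg (t : ℝ) {ζ : ℂ} (hζ : ‖ζ‖ ≤ 1) : 0 ≤ (1 - cis t * ζ).re := by
  have h := (Complex.re_le_norm (cis t * ζ))
  rw [norm_mul, norm_cis, one_mul] at h
  simp only [Complex.sub_re, Complex.one_re]
  linarith

theorem one_sub_cis_mul_re_pos (t : ℝ) {ζ : ℂ} (hζ : ‖ζ‖ < 1) : 0 < (1 - cis t * ζ).re := by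
  have h := (Complex.re_le_norm (cis t * ζ))
  rw [norm_mul, norm_cis, one_mul] at h
  simp only [Complex.sub_re, Complex.one_re]
  linarith

theorem eq_norm_mul_cis_arg (x : ℂ) : x = ‖x‖ * cis x.arg := (Complex.norm_mul_exp_arg_mul_I x).symm

/-- The angle under which a point of the disc sees the two points `cis (±τ)` of the circle. -/
theorem arg_sub_arg_one_sub_cis {τ : ℝ} (hτ : τ ∈ Set.Ioo 0 Real.pi) {ζ : ℂ} (hζ : ‖ζ‖ ≤ 1)
    (hx : 1 - cis τ * ζ ≠ 0) (hy : 1 - cis (-τ) * ζ ≠ 0) :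
    (1 - cis τ * ζ).arg - (1 - cis (-τ) * ζ).arg ∈ Set.Icc (τ - Real.pi) τ ∧
    (‖ζ‖ = 1 →
      ((1 - cis τ * ζ).arg - (1 - cis (-τ) * ζ).arg = τ ∧ 2 * ζ.re - 2 * Real.cos τ < 0) ∨
      ((1 - cis τ * ζ).arg - (1 - cis (-τ) * ζ).arg = τ - Real.pi ∧
        0 < 2 * ζ.re - 2 * Real.cos τ)) := by
  set x := 1 - cis τ * ζ with hxd
  set y := 1 - cis (-τ) * ζ with hyd
  set φ := x.arg - y.arg with hφ
  have hxa : |x.arg| ≤ Real.pi / 2 :=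
    Complex.abs_arg_le_pi_div_two_iff.2 (one_sub_cis_mul_re_nonneg τ hζ)
  have hya : |y.arg| ≤ Real.pi / 2 :=
    Complex.abs_arg_le_pi_div_two_iff.2 (one_sub_cis_mul_re_nonneg (-τ) hζ)
  rw [abs_le] at hxa hya
  have hpos : 0 < ‖x‖ * ‖y‖ := mul_pos (norm_pos_iff.2 hx) (norm_pos_iff.2 hy)
  -- By `e2` this number has imaginary part `-(1 - |ζ|²) sin τ ≤ 0`, which vanishes on the circle;
  -- there its real part `2 cos τ - 2 Re ζ` decides between `φ = τ` and `φ = τ - π`.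
  have e1 : x * (starRingEnd ℂ) y * cis (-τ) = ((‖x‖ * ‖y‖ : ℝ) : ℂ) * cis (φ - τ) := by
    conv_lhs => rw [eq_norm_mul_cis_arg x, eq_norm_mul_cis_arg y, map_mul, conj_cis,
      Complex.conj_ofReal]
    rw [hφ, sub_eq_add_neg, sub_eq_add_neg, cis_add, cis_add]
    push_cast; ring
  have e2 : x * (starRingEnd ℂ) y * cis (-τ) =
      cis (-τ) - (2 * ζ.re : ℝ) + cis τ * (‖ζ‖ ^ 2 : ℝ) := by
    rw [hxd, hyd, map_sub, map_mul, conj_cis, neg_neg, map_one, ← Complex.add_conj,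
      Complex.ofReal_pow, ← Complex.mul_conj']
    linear_combination (-ζ - (starRingEnd ℂ) ζ + cis τ * ζ * (starRingEnd ℂ) ζ) * cis_mul_cis_neg τ
  rw [e1] at e2
  have him := congrArg Complex.im e2
  have hre := congrArg Complex.re e2
  rw [Complex.im_ofReal_mul, cis_im, Complex.add_im, Complex.sub_im, Complex.im_mul_ofReal,
    cis_im, cis_im, Complex.ofReal_im, Real.sin_neg] at him
  rw [Complex.re_ofReal_mul, cis_re, Complex.add_re, Complex.sub_re, Complex.re_mul_ofReal,
    cis_re, cis_re, Complex.ofReal_re, Real.cos_neg] at hre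
  have hs : 0 < Real.sin τ := Real.sin_pos_of_mem_Ioo hτ
  have hζ2 : ‖ζ‖ ^ 2 ≤ 1 := pow_le_one₀ (norm_nonneg _) hζ
  have hsin : Real.sin (φ - τ) ≤ 0 := by
    by_contra! h
    have := mul_pos hpos h
    nlinarith
  obtain ⟨h1, h2⟩ := hτ
  -- Both arguments lie in `[-π/2, π/2]`, so `|φ| ≤ π`. This fixes the branch on which `sin (φ - τ)
  -- ≤ 0` is read.
  have hφ1 : τ - Real.pi ≤ φ := by
    by_contra! h
    have h3 : 0 < Real.sin (φ - τ + 2 * Real.pi) :=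
      Real.sin_pos_of_pos_of_lt_pi (by linarith) (by linarith)
    rw [Real.sin_add_two_pi] at h3
    linarith
  have hφ2 : φ ≤ τ := by
    by_contra! h
    have h3 : 0 < Real.sin (φ - τ) := Real.sin_pos_of_pos_of_lt_pi (by linarith) (by linarith)
    linarith
  refine ⟨⟨hφ1, hφ2⟩, fun h => ?_⟩
  rw [h] at him hre
  have hsin0 : Real.sin (φ - τ) = 0 := by
    have : ‖x‖ * ‖y‖ * Real.sin (φ - τ) = 0 := by rw [him]; ring
    exact (mul_eq_zero.mp this).resolve_left hpos.ne'
  by_cases hc : φ = τ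
  · left
    refine ⟨hc, ?_⟩
    rw [hc, sub_self, Real.cos_zero] at hre
    linarith
  · right
    have hlt : φ - τ < 0 := sub_neg.2 (lt_of_le_of_ne hφ2 hc)
    have hφ3 : φ = τ - Real.pi := by
      by_contra hne
      have hgt : τ - Real.pi < φ := lt_of_le_of_ne hφ1 (Ne.symm hne)
      exact (Real.sin_neg_of_neg_of_neg_pi_lt hlt (by linarith)).ne hsin0
    refine ⟨hφ3, ?_⟩
    rw [hφ3, show τ - Real.pi - τ = -Real.pi by ring, Real.cos_neg, Real.cos_pi] at hre
    linarith

/-! ### Powers of linear functions on the closed disc. -/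

/-- The building block `(1 - cis τ * ζ) ^ ν` of the exterior map of a circular segment. -/
noncomputable def segPow (ν τ : ℝ) (ζ : ℂ) : ℂ := (1 - cis τ * ζ) ^ (ν : ℂ)

theorem segPow_zero (ν τ : ℝ) : segPow ν τ 0 = 1 := by simp [segPow]

-- On the closed disc the base has nonnegative real part, so it meets the branch cut at most at `0`,
-- where a power with positive exponent is continuous.
open Metric in
theorem segPow_diffContOnCl {ν : ℝ} (hν : 0 < ν) (τ : ℝ) :
    DiffContOnCl ℂ (segPow ν τ) (ball 0 1) := by
  refine ⟨fun ζ hζ => ?_, fun ζ hζ => ?_⟩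
  · rw [mem_ball_zero_iff] at hζ
    refine DifferentiableAt.differentiableWithinAt ?_
    refine DifferentiableAt.cpow_const (by fun_prop) (Or.inl (one_sub_cis_mul_re_pos τ hζ))
  · rw [closure_ball _ one_ne_zero, mem_closedBall_zero_iff] at hζ
    refine ContinuousAt.continuousWithinAt ?_
    have h1 : ContinuousAt (fun ζ : ℂ => 1 - cis τ * ζ) ζ := by fun_prop
    exact ContinuousAt.comp (g := fun x : ℂ => x ^ (ν : ℂ))
      (Complex.continuousAt_cpow_const_of_re_pos (Or.inl (one_sub_cis_mul_re_nonneg τ hζ))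
        (by simpa using hν)) h1

theorem segPow_hasDerivAt (ν τ : ℝ) {ζ : ℂ} (hζ : ‖ζ‖ < 1) :
    HasDerivAt (segPow ν τ) (-(ν * cis τ * segPow (ν - 1) τ ζ)) ζ := by
  have h1 : HasDerivAt (fun ζ : ℂ => 1 - cis τ * ζ) (-(cis τ * 1)) ζ :=
    ((hasDerivAt_id ζ).const_mul (cis τ)).const_sub 1
  refine (h1.cpow_const (c := (ν : ℂ)) (Or.inl (one_sub_cis_mul_re_pos τ hζ))).congr_deriv ?_
  simp only [segPow]
  push_cast
  ring

theorem segPow_eq_mul {ν τ : ℝ} {ζ : ℂ} (h : 1 - cis τ * ζ ≠ 0) :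
    segPow ν τ ζ = segPow (ν - 1) τ ζ * (1 - cis τ * ζ) := by
  simp only [segPow]
  push_cast
  rw [Complex.cpow_sub _ _ h, Complex.cpow_one]
  field_simp

theorem segPow_ne_zero {ν τ : ℝ} {ζ : ℂ} (h : 1 - cis τ * ζ ≠ 0) : segPow ν τ ζ ≠ 0 := by
  simp [segPow, Complex.cpow_eq_zero_iff, h]

theorem segPow_eq_zero {ν τ : ℝ} (hν : ν ≠ 0) {ζ : ℂ} (h : 1 - cis τ * ζ = 0) :
    segPow ν τ ζ = 0 := by
  simp [segPow, h, hν]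

theorem segPow_eq_polar (ν τ : ℝ) (ζ : ℂ) :
    segPow ν τ ζ = ((‖1 - cis τ * ζ‖ ^ ν : ℝ) : ℂ) * cis (ν * (1 - cis τ * ζ).arg) := by
  have hc : ∀ t : ℝ, cis t = Real.cos t + Real.sin t * Complex.I := fun t => by
    simp [cis, Complex.exp_mul_I]
  rw [segPow, Complex.cpow_ofReal, hc (ν * _), mul_comm ν]

theorem one_sub_cis_ne_zero_or {τ : ℝ} (hτ : τ ∈ Set.Ioo 0 Real.pi) {ζ : ℂ}
    (hx : 1 - cis τ * ζ = 0) : 1 - cis (-τ) * ζ ≠ 0 := by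
  intro hy
  have hζ : ζ ≠ 0 := by rintro rfl; simp at hx
  exact cis_ne_cis_neg hτ (mul_right_cancel₀ hζ (by linear_combination hy - hx))

/-- Polar form of the quotient of the two building blocks on the closed disc. -/
theorem exists_segPow_eq {β ν τ : ℝ} (hν : 0 < ν) (hτ : τ ∈ Set.Ioo 0 Real.pi)
    (hντ : ν * τ = Real.pi) (hβ : ν * Real.pi = 2 * Real.pi - β) {ζ : ℂ} (hζ : ‖ζ‖ ≤ 1)
    (hx : 1 - cis τ * ζ ≠ 0) (hy : 1 - cis (-τ) * ζ ≠ 0) :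
    ∃ g : ℝ, 0 < g ∧ ∃ η ∈ Set.Icc (β - Real.pi) Real.pi,
      segPow ν τ ζ = g * cis η * segPow ν (-τ) ζ ∧ (ζ ≠ 0 → g = 1 → η ≠ 0) ∧
      (‖ζ‖ = 1 → (η = Real.pi ∧ 2 * ζ.re - 2 * Real.cos τ < 0) ∨
        (η = β - Real.pi ∧ 0 < 2 * ζ.re - 2 * Real.cos τ)) := by
  obtain ⟨⟨h1, h2⟩, h3⟩ := arg_sub_arg_one_sub_cis hτ hζ hx hy
  have hyn : 0 < ‖1 - cis (-τ) * ζ‖ := norm_pos_iff.2 hy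
  have hxn : 0 < ‖1 - cis τ * ζ‖ := norm_pos_iff.2 hx
  have hyp := Real.rpow_pos_of_pos hyn ν
  have hxp := Real.rpow_pos_of_pos hxn ν
  -- The angle range `[τ - π, τ]` is scaled by `ν`; since `ν τ = π` and `ν π = 2π - β`, it becomes
  -- `[β - π, π]`.
  refine ⟨‖1 - cis τ * ζ‖ ^ ν / ‖1 - cis (-τ) * ζ‖ ^ ν, div_pos hxp hyp,
    ν * ((1 - cis τ * ζ).arg - (1 - cis (-τ) * ζ).arg), ⟨?_, ?_⟩, ?_, ?_, ?_⟩
  · nlinarith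
  · nlinarith
  · rw [segPow_eq_polar, segPow_eq_polar,
      show ν * (1 - cis τ * ζ).arg = ν * ((1 - cis τ * ζ).arg - (1 - cis (-τ) * ζ).arg) +
        ν * (1 - cis (-τ) * ζ).arg by ring, cis_add]
    have : ((‖1 - cis (-τ) * ζ‖ ^ ν : ℝ) : ℂ) ≠ 0 := by exact_mod_cast hyp.ne'
    rw [Complex.ofReal_div]
    generalize ((‖1 - cis (-τ) * ζ‖ ^ ν : ℝ) : ℂ) = Y at this ⊢
    field_simp
  · intro hζ0 hg hη
    rw [div_eq_one_iff_eq hyp.ne'] at hg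
    have hn := (Real.rpow_left_inj hxn.le hyn.le hν.ne').1 hg
    have ha := sub_eq_zero.1 ((mul_eq_zero.1 hη).resolve_left hν.ne')
    have := eq_norm_mul_cis_arg (1 - cis τ * ζ)
    rw [hn, ha, ← eq_norm_mul_cis_arg] at this
    exact cis_ne_cis_neg hτ (mul_right_cancel₀ hζ0 (by linear_combination -this))
  · intro h
    rcases h3 h with ⟨h4, h5⟩ | ⟨h4, h5⟩
    · exact Or.inl ⟨by rw [h4, hντ], h5⟩
    · exact Or.inr ⟨by rw [h4, mul_sub, hντ, hβ]; ring, h5⟩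

/-! ### The circular segment and its exterior map. -/

/-- The open circular segment `|z| < 1`, `Re z > cos β`. -/
def circSegment (β : ℝ) : Set ℂ := {z | ‖z‖ < 1 ∧ Real.cos β < z.re}

theorem mem_closure_circSegment {β : ℝ} (hβ : β ∈ Set.Ioo 0 (Real.pi / 2)) {z : ℂ} (hz : ‖z‖ ≤ 1)
    (hre : Real.cos β ≤ z.re) : z ∈ closure (circSegment β) := by
  rw [Metric.mem_closure_iff]
  intro ε hε
  have hc0 : 0 < Real.cos β := Real.cos_pos_of_mem_Ioo ⟨by linarith [hβ.1, Real.pi_pos], hβ.2⟩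
  have hc1 : Real.cos β < 1 := by
    have := Real.cos_lt_cos_of_nonneg_of_le_pi_div_two le_rfl hβ.2.le hβ.1
    rwa [Real.cos_zero] at this
  -- A real point inside the segment; moving `z` slightly towards it makes both inequalities strict.
  set c : ℝ := (1 + Real.cos β) / 2 with hc
  set s : ℝ := min (1 / 2) (ε / 4) with hs
  have hs0 : 0 < s := lt_min (by norm_num) (by linarith)
  have hs1 : s ≤ 1 / 2 := min_le_left _ _
  have hs2 : s ≤ ε / 4 := min_le_right _ _
  refine ⟨((1 - s : ℝ) : ℂ) * z + ((s * c : ℝ) : ℂ), ⟨?_, ?_⟩, ?_⟩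
  · refine (norm_add_le _ _).trans_lt ?_
    rw [norm_mul, Complex.norm_real, Complex.norm_real, Real.norm_of_nonneg (by linarith),
      Real.norm_of_nonneg (by positivity)]
    nlinarith
  · rw [Complex.add_re, Complex.re_ofReal_mul, Complex.ofReal_re]
    nlinarith
  · rw [dist_eq_norm, show z - (((1 - s : ℝ) : ℂ) * z + ((s * c : ℝ) : ℂ)) =
      (s : ℂ) * (z - (c : ℂ)) by push_cast; ring, norm_mul, Complex.norm_real,
      Real.norm_of_nonneg hs0.le]
    have h1 : ‖z - (c : ℂ)‖ ≤ 2 := by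
      refine (norm_sub_le _ _).trans ?_
      rw [Complex.norm_real, Real.norm_of_nonneg (by positivity)]
      linarith
    nlinarith

theorem re_inv_nonneg {w : ℂ} (h : 0 ≤ w.re) : 0 ≤ (w⁻¹).re := by
  rw [Complex.inv_re]
  exact div_nonneg h (Complex.normSq_nonneg _)

/-- Numerical data of the exterior map of the segment `circSegment β`. -/
structure IsSegmentData (β ν τ : ℝ) : Prop where
  beta_mem : β ∈ Set.Ioo 0 (Real.pi / 2)
  one_lt : 1 < ν
  tau_mem : τ ∈ Set.Ioo 0 Real.pi
  mul_tau : ν * τ = Real.pi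
  mul_pi : ν * Real.pi = 2 * Real.pi - β

namespace IsSegmentData

variable {β ν τ : ℝ}

theorem beta_mem_Ioo_pi (h : IsSegmentData β ν τ) : β ∈ Set.Ioo 0 Real.pi :=
  ⟨h.beta_mem.1, by linarith [h.beta_mem.2, Real.pi_pos]⟩

theorem nu_pos (h : IsSegmentData β ν τ) : 0 < ν := by linarith [h.one_lt]

theorem exists_eq (h : IsSegmentData β ν τ) {ζ : ℂ} (hζ : ‖ζ‖ ≤ 1)
    (hx : 1 - cis τ * ζ ≠ 0) (hy : 1 - cis (-τ) * ζ ≠ 0) :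
    ∃ g : ℝ, 0 < g ∧ ∃ η ∈ Set.Icc (β - Real.pi) Real.pi,
      segPow ν τ ζ = g * cis η * segPow ν (-τ) ζ ∧ (ζ ≠ 0 → g = 1 → η ≠ 0) ∧
      (‖ζ‖ = 1 → (η = Real.pi ∧ 2 * ζ.re - 2 * Real.cos τ < 0) ∨
        (η = β - Real.pi ∧ 0 < 2 * ζ.re - 2 * Real.cos τ)) :=
  exists_segPow_eq h.nu_pos h.tau_mem h.mul_tau h.mul_pi hζ hx hy

/-- The exterior map has no pole except at `0`: a quotient of powers equal to `1` forces `g = 1`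
and, as `|η| < 2π`, also `η = 0`. -/
theorem segPow_sub_ne_zero (h : IsSegmentData β ν τ) {ζ : ℂ} (hζ : ‖ζ‖ ≤ 1) (h0 : ζ ≠ 0) :
    segPow ν (-τ) ζ - segPow ν τ ζ ≠ 0 := by
  by_cases hx : 1 - cis τ * ζ = 0
  · rw [segPow_eq_zero h.nu_pos.ne' hx, sub_zero]
    exact segPow_ne_zero (one_sub_cis_ne_zero_or h.tau_mem hx)
  by_cases hy : 1 - cis (-τ) * ζ = 0
  · rw [segPow_eq_zero h.nu_pos.ne' hy, zero_sub, neg_ne_zero]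
    exact segPow_ne_zero hx
  obtain ⟨g, hg, η, hη, he, hne, -⟩ := h.exists_eq hζ hx hy
  have hB := segPow_ne_zero (ν := ν) hy
  intro hs
  rw [he, sub_eq_zero] at hs
  have h1 : (g : ℂ) * cis η = 1 := mul_right_cancel₀ hB (by rw [one_mul]; exact hs.symm)
  have h2 : g = 1 := by
    have := congrArg norm h1
    rwa [norm_mul, norm_cis, mul_one, Complex.norm_real, Real.norm_of_nonneg hg.le, norm_one] at this
  rw [h2, Complex.ofReal_one, one_mul] at h1
  have h3 := congrArg Complex.re h1
  rw [cis_re, Complex.one_re, Real.cos_eq_one_iff_of_lt_of_lt] at h3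
  · exact hne h0 h2 h3
  · linarith [hη.1, h.beta_mem.1, Real.pi_pos]
  · linarith [hη.2, Real.pi_pos]

/-- The exterior map `ψ` satisfies `(ψ - cis β) / (ψ - cis (-β)) = ((1 - cis τ ζ) / (1 - cis (-τ)
ζ)) ^ ν`, so a zero here would mean `ψ ζ = z`. The Möbius map on the left sends the segment to the
sector of arguments in `(-π, β - π)`, disjoint from the arguments `η ∈ [β - π, π]` available on the
right. -/
theorem segment_ne_zero (h : IsSegmentData β ν τ) {ζ z : ℂ} (hζ : ‖ζ‖ ≤ 1)
    (hz : z ∈ circSegment β) :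
    (z - cis (-β)) * segPow ν τ ζ - (z - cis β) * segPow ν (-τ) ζ ≠ 0 := by
  obtain ⟨hz1, hz2⟩ := hz
  have hne : ∀ t, z - cis t ≠ 0 := by
    intro t ht
    rw [sub_eq_zero.1 ht, norm_cis] at hz1
    exact lt_irrefl _ hz1
  by_cases hx : 1 - cis τ * ζ = 0
  · rw [segPow_eq_zero h.nu_pos.ne' hx, mul_zero, zero_sub, neg_ne_zero]
    exact mul_ne_zero (hne _) (segPow_ne_zero (one_sub_cis_ne_zero_or h.tau_mem hx))
  by_cases hy : 1 - cis (-τ) * ζ = 0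
  · rw [segPow_eq_zero h.nu_pos.ne' hy, mul_zero, sub_zero]
    exact mul_ne_zero (hne _) (segPow_ne_zero hx)
  obtain ⟨g, hg, η, hη, he, -, -⟩ := h.exists_eq hζ hx hy
  have hB := segPow_ne_zero (ν := ν) hy
  intro hs
  rw [he, ← mul_assoc, ← sub_mul] at hs
  have h1 := (mul_eq_zero.1 hs).resolve_right hB
  have hsinβ := Real.sin_pos_of_mem_Ioo h.beta_mem_Ioo_pi
  have hN : 0 < ‖z - cis (-β)‖ ^ 2 := by have := norm_pos_iff.2 (hne (-β)); positivity
  have e1 : ((g * ‖z - cis (-β)‖ ^ 2 : ℝ) : ℂ) * cis η =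
      (‖z‖ ^ 2 : ℝ) - (2 * z.re : ℝ) * cis β + cis β * cis β := by
    push_cast
    rw [← Complex.mul_conj', ← Complex.mul_conj', map_sub, conj_cis, neg_neg]
    have := Complex.add_conj z
    push_cast at this
    rw [← this]
    linear_combination ((starRingEnd ℂ) z - cis β) * h1
  have e2 : ((g * ‖z - cis (-β)‖ ^ 2 : ℝ) : ℂ) * cis (η - β) =
      (‖z‖ ^ 2 : ℝ) * cis (-β) - (2 * z.re : ℝ) + cis β := by
    rw [sub_eq_add_neg η, cis_add]
    linear_combination cis (-β) * e1 + (cis β - ((2 * z.re : ℝ) : ℂ)) * cis_mul_cis_neg β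
  rw [← cis_add] at e1
  have i1 := congrArg Complex.im e1
  have i2 := congrArg Complex.im e2
  simp only [Complex.add_im, Complex.sub_im, Complex.im_ofReal_mul, cis_im, Complex.ofReal_im,
    Real.sin_neg, ← two_mul, Real.sin_two_mul] at i1 i2
  have hpos : 0 < g * ‖z - cis (-β)‖ ^ 2 := mul_pos hg hN
  have hz2' : ‖z‖ ^ 2 < 1 := pow_lt_one₀ (norm_nonneg _) hz1 two_ne_zero
  -- `sin η < 0` encodes `Re z > cos β`, and `sin (η - β) > 0` encodes `|z| < 1`.
  have s1 : Real.sin η < 0 := by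
    by_contra! hc
    have := mul_nonneg hpos.le hc
    nlinarith
  have s2 : 0 < Real.sin (η - β) := by
    by_contra! hc
    have := mul_nonneg hpos.le (neg_nonneg.2 hc)
    nlinarith
  have hη0 : η < 0 := by
    by_contra! hc
    linarith [Real.sin_nonneg_of_nonneg_of_le_pi hc hη.2]
  have := Real.sin_nonpos_of_nonpos_of_neg_pi_le (x := η - β) (by linarith [h.beta_mem.1])
    (by linarith [hη.1])
  linarith

/-- The denominator `((1 - ā ζ) ^ ν - (1 - a ζ) ^ ν) / ζ` of the exterior map. -/
noncomputable def _root_.segDen (ν τ : ℝ) : ℂ → ℂ :=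
  dslope (fun ζ => segPow ν (-τ) ζ - segPow ν τ ζ) 0

/-- The exterior map of the segment, multiplied by `ζ`. -/
noncomputable def _root_.segMap (β ν τ : ℝ) (ζ : ℂ) : ℂ :=
  (cis β * segPow ν (-τ) ζ - cis (-β) * segPow ν τ ζ) / segDen ν τ ζ

/-- The function `-ζ² ψ' ζ` for the exterior map `ψ` of the segment. -/
noncomputable def _root_.segDeriv (β ν τ : ℝ) (ζ : ℂ) : ℂ :=
  ν * (cis τ - cis (-τ)) * (cis β - cis (-β)) *
    (segPow (ν - 1) τ ζ * segPow (ν - 1) (-τ) ζ) * ((segDen ν τ ζ)⁻¹ * (segDen ν τ ζ)⁻¹)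

theorem _root_.mul_segDen (ν τ : ℝ) (ζ : ℂ) :
    ζ * segDen ν τ ζ = segPow ν (-τ) ζ - segPow ν τ ζ := by
  rw [segDen, mul_dslope_zero, segPow_zero, segPow_zero, sub_self, sub_zero]

theorem _root_.segDen_zero (ν τ : ℝ) : segDen ν τ 0 = ν * (cis τ - cis (-τ)) := by
  have h0 : ‖(0 : ℂ)‖ < 1 := by simp
  rw [segDen, dslope_same]
  have h := (segPow_hasDerivAt ν (-τ) h0).sub (segPow_hasDerivAt ν τ h0)
  have h2 := HasDerivAt.deriv h
  simp only [segPow_zero] at h2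
  refine h2.trans ?_
  ring

theorem cis_sub_ne_zero (h : IsSegmentData β ν τ) : cis τ - cis (-τ) ≠ 0 :=
  sub_ne_zero.2 (cis_ne_cis_neg h.tau_mem)

theorem cis_beta_sub_ne_zero (h : IsSegmentData β ν τ) : cis β - cis (-β) ≠ 0 :=
  sub_ne_zero.2 (cis_ne_cis_neg h.beta_mem_Ioo_pi)

theorem segDen_ne_zero (h : IsSegmentData β ν τ) {ζ : ℂ} (hζ : ‖ζ‖ ≤ 1) : segDen ν τ ζ ≠ 0 := by
  by_cases h0 : ζ = 0
  · rw [h0, segDen_zero]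
    exact mul_ne_zero (by exact_mod_cast h.nu_pos.ne') h.cis_sub_ne_zero
  · have := h.segPow_sub_ne_zero hζ h0
    rw [← mul_segDen] at this
    exact right_ne_zero_of_mul this

open Metric

theorem inv_segDen_diffContOnCl (h : IsSegmentData β ν τ) :
    DiffContOnCl ℂ (fun ζ => (segDen ν τ ζ)⁻¹) (ball 0 1) := by
  have h1 : DiffContOnCl ℂ (segDen ν τ) (ball 0 1) :=
    ((segPow_diffContOnCl h.nu_pos (-τ)).sub (segPow_diffContOnCl h.nu_pos τ)).dslope_zero
  refine h1.inv fun ζ hζ => h.segDen_ne_zero ?_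
  rwa [closure_ball _ one_ne_zero, mem_closedBall_zero_iff] at hζ

theorem segMap_diffContOnCl (h : IsSegmentData β ν τ) :
    DiffContOnCl ℂ (segMap β ν τ) (ball 0 1) := by
  have h1 := (((segPow_diffContOnCl h.nu_pos (-τ)).const_smul (cis β)).sub
    ((segPow_diffContOnCl h.nu_pos τ).const_smul (cis (-β)))).smul h.inv_segDen_diffContOnCl
  exact h1

theorem segDeriv_diffContOnCl (h : IsSegmentData β ν τ) :
    DiffContOnCl ℂ (segDeriv β ν τ) (ball 0 1) := by
  have hν : 0 < ν - 1 := by linarith [h.one_lt]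
  exact (((segPow_diffContOnCl hν τ).smul (segPow_diffContOnCl hν (-τ))).const_smul
    (ν * (cis τ - cis (-τ)) * (cis β - cis (-β)))).smul
    (h.inv_segDen_diffContOnCl.smul h.inv_segDen_diffContOnCl)

theorem _root_.segMap_zero (β ν τ : ℝ) :
    segMap β ν τ 0 = (cis β - cis (-β)) / (ν * (cis τ - cis (-τ))) := by
  rw [segMap, segDen_zero, segPow_zero, segPow_zero, mul_one, mul_one]

theorem segDeriv_zero (h : IsSegmentData β ν τ) : segDeriv β ν τ 0 = segMap β ν τ 0 := by
  have h1 := h.cis_sub_ne_zero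
  have h2 : (ν : ℂ) ≠ 0 := by exact_mod_cast h.nu_pos.ne'
  rw [segMap_zero, segDeriv, segDen_zero, segPow_zero, segPow_zero]
  field_simp

theorem segMap_zero_ne_zero (h : IsSegmentData β ν τ) : segMap β ν τ 0 ≠ 0 := by
  have h2 : (ν : ℂ) ≠ 0 := by exact_mod_cast h.nu_pos.ne'
  rw [segMap_zero]
  exact div_ne_zero h.cis_beta_sub_ne_zero (mul_ne_zero h2 h.cis_sub_ne_zero)

theorem _root_.segMap_div (β ν τ : ℝ) (ζ : ℂ) : segMap β ν τ ζ / ζ =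
    (cis β * segPow ν (-τ) ζ - cis (-β) * segPow ν τ ζ) / (segPow ν (-τ) ζ - segPow ν τ ζ) := by
  rw [segMap, div_div, mul_comm (segDen ν τ ζ), mul_segDen]

theorem segMap_sub (h : IsSegmentData β ν τ) {ζ : ℂ} (hζ : ‖ζ‖ ≤ 1) (z : ℂ) :
    segMap β ν τ ζ - z * ζ =
      ((z - cis (-β)) * segPow ν τ ζ - (z - cis β) * segPow ν (-τ) ζ) / segDen ν τ ζ := by
  have h1 := h.segDen_ne_zero hζ
  rw [segMap, eq_div_iff h1, sub_mul, div_mul_cancel₀ _ h1, mul_assoc, mul_segDen]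
  ring

theorem segMap_sub_ne_zero (h : IsSegmentData β ν τ) {ζ z : ℂ} (hζ : ‖ζ‖ ≤ 1)
    (hz : z ∈ circSegment β) : segMap β ν τ ζ - z * ζ ≠ 0 := by
  rw [h.segMap_sub hζ]
  exact div_ne_zero (h.segment_ne_zero hζ hz) (h.segDen_ne_zero hζ)

theorem segMap_div_hasDerivAt (h : IsSegmentData β ν τ) {ζ : ℂ} (hζ : ‖ζ‖ < 1) (h0 : ζ ≠ 0) :
    HasDerivAt (fun ζ => segMap β ν τ ζ / ζ) (-(segDeriv β ν τ ζ / ζ ^ 2)) ζ := by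
  have hD := h.segDen_ne_zero hζ.le
  have hne := h.segPow_sub_ne_zero hζ.le h0
  have hA := segPow_hasDerivAt ν τ hζ
  have hB := segPow_hasDerivAt ν (-τ) hζ
  have hd := ((hB.const_mul (cis β)).sub (hA.const_mul (cis (-β)))).div (hB.sub hA) hne
  refine (hd.congr_deriv ?_).congr_of_eventuallyEq
    (Filter.Eventually.of_forall fun w => segMap_div β ν τ w)
  have hnz : ∀ t, 1 - cis t * ζ ≠ 0 := fun t ht => by
    have := one_sub_cis_mul_re_pos t hζ
    rw [ht] at this
    exact lt_irrefl _ this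
  have eA := segPow_eq_mul (ν := ν) (hnz τ)
  have eB := segPow_eq_mul (ν := ν) (hnz (-τ))
  simp only [Pi.sub_apply]
  rw [segDeriv, div_eq_iff (pow_ne_zero 2 hne), ← mul_segDen]
  have : -((ν : ℂ) * (cis τ - cis (-τ)) * (cis β - cis (-β)) *
      (segPow (ν - 1) τ ζ * segPow (ν - 1) (-τ) ζ) * ((segDen ν τ ζ)⁻¹ * (segDen ν τ ζ)⁻¹) / ζ ^ 2)
      * (ζ * segDen ν τ ζ) ^ 2 = -((ν : ℂ) * (cis τ - cis (-τ)) * (cis β - cis (-β)) *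
      (segPow (ν - 1) τ ζ * segPow (ν - 1) (-τ) ζ)) := by
    field_simp
  rw [this, mul_segDen, eA, eB]
  ring

end IsSegmentData

/-! ### Boundary values of the exterior map, convexity, and its zero. -/

/-- This makes the parametrisation `(cis β + g) / (1 + g cis β)` of the arc unimodular. -/
theorem norm_one_add_mul_cis (g β : ℝ) : ‖1 + g * cis β‖ = ‖cis β + g‖ := by
  have h : 1 + g * cis β = cis β * (starRingEnd ℂ) (cis β + g) := by
    rw [map_add, conj_cis, Complex.conj_ofReal]
    linear_combination -cis_mul_cis_neg β
  rw [h, norm_mul, norm_cis, one_mul, RCLike.norm_conj]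

theorem one_add_mul_cis_ne_zero {g β : ℝ} (hg : 0 < g) (hβ : β ∈ Set.Ioo 0 Real.pi) :
    1 + g * cis β ≠ 0 := by
  intro h
  have h1 := congrArg Complex.im h
  rw [Complex.add_im, Complex.im_ofReal_mul, cis_im] at h1
  have := mul_pos hg (Real.sin_pos_of_mem_Ioo hβ)
  simp at h1
  rcases h1 with h1 | h1 <;> simp [h1] at this

namespace IsSegmentData

variable {β ν τ : ℝ}

theorem segMap_div_mem_closure (h : IsSegmentData β ν τ) {ζ : ℂ} (hζ : ‖ζ‖ = 1) :
    segMap β ν τ ζ / ζ ∈ closure (circSegment β) := by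
  have h0 : ζ ≠ 0 := by rintro rfl; simp at hζ
  rw [segMap_div]
  have hcis : ∀ t, Real.cos t = Real.cos β → cis t ∈ closure (circSegment β) := fun t ht =>
    mem_closure_circSegment h.beta_mem (norm_cis t).le (by rw [cis_re, ht])
  by_cases hx : 1 - cis τ * ζ = 0
  · have := segPow_ne_zero (ν := ν) (one_sub_cis_ne_zero_or h.tau_mem hx)
    rw [segPow_eq_zero h.nu_pos.ne' hx, mul_zero, sub_zero, sub_zero, mul_div_cancel_right₀ _ this]
    exact hcis β rfl
  by_cases hy : 1 - cis (-τ) * ζ = 0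
  · have := segPow_ne_zero (ν := ν) hx
    rw [segPow_eq_zero h.nu_pos.ne' hy, mul_zero, zero_sub, zero_sub, neg_div_neg_eq,
      mul_div_cancel_right₀ _ this]
    exact hcis (-β) (Real.cos_neg β)
  obtain ⟨g, hg, η, -, he, -, hbd⟩ := h.exists_eq hζ.le hx hy
  have hB := segPow_ne_zero (ν := ν) hy
  have e1 : (cis β * segPow ν (-τ) ζ - cis (-β) * segPow ν τ ζ) /
      (segPow ν (-τ) ζ - segPow ν τ ζ) =
      (cis β - cis (-β) * (g * cis η)) / (1 - g * cis η) := by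
    rw [he, ← mul_div_mul_right (cis β - cis (-β) * (g * cis η)) (1 - g * cis η) hB]
    congr 1 <;> ring
  rw [e1]
  -- For `η = π` the value is a convex combination of the two corners, a point of the chord; for `η
  -- = β - π` it lies on the arc.
  rcases hbd hζ with ⟨rfl, -⟩ | ⟨rfl, -⟩
  · have hc : cis Real.pi = -1 := by simp [cis]
    have hg1 : (0 : ℝ) < 1 + g := by linarith
    rw [hc]
    have e2 : (cis β - cis (-β) * (g * -1)) / (1 - g * -1) =
        (((1 + g)⁻¹ : ℝ) : ℂ) * (cis β + (g : ℂ) * cis (-β)) := by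
      push_cast
      rw [div_eq_inv_mul]
      congr 1 <;> ring
    rw [e2]
    refine mem_closure_circSegment h.beta_mem ?_ ?_
    · rw [norm_mul, Complex.norm_real, Real.norm_of_nonneg (by positivity)]
      have h3 := norm_add_le (cis β) ((g : ℂ) * cis (-β))
      rw [norm_mul, norm_cis, norm_cis, Complex.norm_real, Real.norm_of_nonneg hg.le] at h3
      rw [inv_mul_le_iff₀ hg1]
      linarith
    · rw [Complex.re_ofReal_mul, Complex.add_re, Complex.re_ofReal_mul, cis_re, cis_re,
        Real.cos_neg, le_inv_mul_iff₀ hg1]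
      linarith
  · have hc : cis (β - Real.pi) = -cis β := by
      rw [sub_eq_add_neg, cis_add]; simp [cis, Complex.exp_neg]
    have hne := one_add_mul_cis_ne_zero hg h.beta_mem_Ioo_pi
    have e2 : (cis β - cis (-β) * (g * cis (β - Real.pi))) / (1 - g * cis (β - Real.pi)) =
        (cis β + g) / (1 + g * cis β) := by
      rw [hc]
      congr 1
      · linear_combination (g : ℂ) * cis_mul_cis_neg β
      · ring
    rw [e2]
    refine mem_closure_circSegment h.beta_mem ?_ ?_
    · rw [norm_div, norm_one_add_mul_cis, div_self]
      rw [← norm_one_add_mul_cis]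
      exact norm_ne_zero_iff.2 hne
    · have hn := Complex.normSq_pos.2 hne
      rw [Complex.div_re, ← add_div, le_div_iff₀ hn, Complex.normSq_apply]
      simp only [Complex.add_re, Complex.add_im, Complex.re_ofReal_mul, Complex.im_ofReal_mul,
        cis_re, cis_im, Complex.ofReal_re, Complex.ofReal_im, Complex.one_re, Complex.one_im]
      have hs := Real.sin_sq_add_cos_sq β
      have hs2 := mul_nonneg hg.le (sq_nonneg (Real.sin β))
      rw [← sub_nonneg]
      refine (mul_nonneg two_pos.le hs2).trans_eq ?_
      linear_combination (g + g ^ 2 * Real.cos β) * hs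

/-- This is convexity: the boundary curve, seen from any `z` of the segment, turns in one direction
only. On each of the two boundary pieces the claim reduces to the inequality that defines the
corresponding side of the segment. -/
theorem re_segDeriv_div_nonneg (h : IsSegmentData β ν τ) {ζ z : ℂ} (hζ : ‖ζ‖ = 1)
    (hz : z ∈ circSegment β) :
    0 ≤ (segDeriv β ν τ ζ / (segMap β ν τ ζ - z * ζ)).re := by
  have h0 : ζ ≠ 0 := by rintro rfl; simp at hζ
  have hν : ν - 1 ≠ 0 := by linarith [h.one_lt]
  have hD := h.segDen_ne_zero hζ.le
  -- At the corners the numerator vanishes because the exponent `ν - 1` is nonzero.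
  by_cases hx : 1 - cis τ * ζ = 0
  · simp [segDeriv, segPow_eq_zero hν hx]
  by_cases hy : 1 - cis (-τ) * ζ = 0
  · simp [segDeriv, segPow_eq_zero hν hy]
  obtain ⟨g, hg, η, -, he, -, hbd⟩ := h.exists_eq hζ.le hx hy
  have hB := segPow_ne_zero (ν := ν) hy
  set t : ℝ := 2 * ζ.re - 2 * Real.cos τ with ht
  have hxy : (1 - cis τ * ζ) * (1 - cis (-τ) * ζ) = t * ζ := by
    have h1 : ζ * (starRingEnd ℂ) ζ = 1 := by rw [Complex.mul_conj', hζ]; simp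
    have h2 := cis_add_cis_neg τ
    have h3 := Complex.add_conj ζ
    rw [ht, Complex.ofReal_sub, ← h2, ← h3]
    linear_combination ζ ^ 2 * cis_mul_cis_neg τ - h1
  have ht0 : t ≠ 0 := by
    rcases hbd hζ with ⟨-, h1⟩ | ⟨-, h1⟩
    · exact h1.ne
    · exact h1.ne'
  have ht0' : (t : ℂ) ≠ 0 := by exact_mod_cast ht0
  set w := (1 - g * cis η) * ((z - cis (-β)) * (g * cis η) - (z - cis β)) with hw
  set c : ℝ := 4 * ν * Real.sin τ * Real.sin β with hc
  have hcpos : 0 < c := by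
    have := Real.sin_pos_of_mem_Ioo h.beta_mem_Ioo_pi
    have := Real.sin_pos_of_mem_Ioo h.tau_mem
    have := h.nu_pos
    positivity
  -- All powers cancel. What remains is a real factor with the sign of `t`, negative on the chord
  -- and positive on the arc, times an explicit function of `z`, `g` and `η`.
  have key : segDeriv β ν τ ζ / (segMap β ν τ ζ - z * ζ) =
      ((g * (c / t) : ℝ) : ℂ) * (-cis η * w⁻¹) := by
    have hX : segPow (ν - 1) τ ζ * segPow (ν - 1) (-τ) ζ =
        g * cis η * segPow ν (-τ) ζ ^ 2 / (t * ζ) := by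
      rw [eq_div_iff (mul_ne_zero ht0' h0), ← hxy]
      have eA := segPow_eq_mul (ν := ν) hx
      have eB := segPow_eq_mul (ν := ν) hy
      rw [he] at eA
      linear_combination (-segPow ν (-τ) ζ) * eA -
        segPow (ν - 1) τ ζ * (1 - cis τ * ζ) * eB
    have hc' : (ν : ℂ) * (cis τ - cis (-τ)) * (cis β - cis (-β)) = -(c : ℂ) := by
      rw [cis_sub_cis_neg, cis_sub_cis_neg, hc]
      push_cast
      linear_combination (4 * ν * Complex.sin τ * Complex.sin β) * Complex.I_mul_I
    have hden : (z - cis (-β)) * segPow ν τ ζ - (z - cis β) * segPow ν (-τ) ζ =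
        ((z - cis (-β)) * (g * cis η) - (z - cis β)) * segPow ν (-τ) ζ := by rw [he]; ring
    have hD2 : segDen ν τ ζ * ζ = (1 - g * cis η) * segPow ν (-τ) ζ := by
      rw [mul_comm, mul_segDen, he]; ring
    have hne1 := h.segment_ne_zero hζ.le hz
    rw [hden] at hne1
    have hne2 := left_ne_zero_of_mul hne1
    have hne3 : (1 - g * cis η) ≠ 0 :=
      left_ne_zero_of_mul (hD2 ▸ mul_ne_zero hD h0 : (1 - g * cis η) * segPow ν (-τ) ζ ≠ 0)
    rw [h.segMap_sub hζ.le, segDeriv, hc', hX, hden, hw]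
    have hD3 : segDen ν τ ζ = (1 - g * cis η) * segPow ν (-τ) ζ / ζ := by
      rw [eq_div_iff h0, hD2]
    rw [hD3]
    push_cast
    generalize (z - cis (-β)) * (g * cis η) - (z - cis β) = u at hne2 ⊢
    generalize (1 : ℂ) - g * cis η = v at hne3 ⊢
    field_simp
  rw [key, Complex.re_ofReal_mul]
  obtain ⟨hz1, hz2⟩ := hz
  rcases hbd hζ with ⟨rfl, h1⟩ | ⟨rfl, h1⟩
  · have hcπ : cis Real.pi = -1 := by simp [cis]
    refine mul_nonneg_of_nonpos_of_nonpos
      (mul_nonpos_of_nonneg_of_nonpos hg.le (div_nonpos_of_nonneg_of_nonpos hcpos.le h1.le)) ?_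
    have hw' : w = -(((1 + g : ℝ) : ℂ) * (((1 + g : ℝ) : ℂ) * z - (cis β + g * cis (-β)))) := by
      rw [hw, hcπ]; push_cast; ring
    rw [hw', hcπ, inv_neg, neg_neg, one_mul, Complex.neg_re]
    refine neg_nonpos.2 (re_inv_nonneg ?_)
    rw [Complex.re_ofReal_mul, Complex.sub_re, Complex.re_ofReal_mul, Complex.add_re,
      Complex.re_ofReal_mul, cis_re, cis_re, Real.cos_neg]
    have : 0 ≤ (1 + g) * (z.re - Real.cos β) := by
      have : 0 < z.re - Real.cos β := by linarith
      positivity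
    nlinarith
  · have hcπ : cis (β - Real.pi) = -cis β := by
      rw [sub_eq_add_neg, cis_add]; simp [cis, Complex.exp_neg]
    refine mul_nonneg (mul_nonneg hg.le (div_nonneg hcpos.le h1.le)) ?_
    have hw' : -cis (β - Real.pi) * w⁻¹ =
        ((cis (-β) + g) * ((cis β + g) - z * (1 + g * cis β)))⁻¹ := by
      rw [hw, hcπ, neg_neg]
      have e1 : (1 - g * -cis β) = cis β * (cis (-β) + g) := by
        linear_combination -cis_mul_cis_neg β
      have e2 : (z - cis (-β)) * (g * -cis β) - (z - cis β) =
          (cis β + g) - z * (1 + g * cis β) := by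
        linear_combination (g : ℂ) * cis_mul_cis_neg β
      rw [e1, e2, mul_assoc, mul_inv, ← mul_assoc, mul_inv_cancel₀ (cis_ne_zero β), one_mul]
    rw [hw']
    refine re_inv_nonneg ?_
    have e3 : cis (-β) + g = (starRingEnd ℂ) (cis β + g) := by
      rw [map_add, conj_cis, Complex.conj_ofReal]
    rw [e3, mul_sub, Complex.conj_mul', Complex.sub_re, ← Complex.ofReal_pow, Complex.ofReal_re,
      sub_nonneg]
    refine (Complex.re_le_norm _).trans ?_
    rw [norm_mul, norm_mul, RCLike.norm_conj, norm_one_add_mul_cis]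
    nlinarith [norm_nonneg (cis β + g), mul_nonneg (norm_nonneg (cis β + g)) (norm_nonneg (cis β + g))]

/-- The exterior map vanishes at `-2 sin (β / (2 ν))`. -/
theorem segMap_eq_zero (h : IsSegmentData β ν τ) :
    segMap β ν τ (-((2 * Real.sin (β / (2 * ν)) : ℝ) : ℂ)) = 0 := by
  have hν := h.nu_pos
  set s := β / (2 * ν) with hs
  have hνs : ν * (2 * s) = β := by rw [hs]; field_simp
  -- Consequently `1 + 2 sin s · cis τ = cis (2s)`, whose `ν`th power is `cis β`. The two terms of
  -- the numerator of `segMap` then both equal `1`.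
  have hτs : τ = Real.pi / 2 + s := by
    have h1 : ν * τ = ν * (Real.pi / 2 + s) := by
      rw [h.mul_tau]; linarith [h.mul_pi]
    exact mul_left_cancel₀ hν.ne' h1
  have hs0 : 0 < s := div_pos h.beta_mem.1 (by positivity)
  have hs1 : 2 * s < Real.pi := by
    have := h.tau_mem.2
    rw [hτs] at this
    linarith
  have hI : cis (Real.pi / 2) = Complex.I := by
    apply Complex.ext <;> simp [cis_re, cis_im]
  have hI2 : cis (-(Real.pi / 2)) = -Complex.I := by
    apply Complex.ext <;> simp [cis_re, cis_im]
  have hsin : ((2 * Real.sin s : ℝ) : ℂ) = -Complex.I * (cis s - cis (-s)) := by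
    rw [cis_sub_cis_neg]
    push_cast
    linear_combination (2 * Complex.sin s) * Complex.I_mul_I
  have e1 : 1 - cis τ * (-((2 * Real.sin s : ℝ) : ℂ)) = cis (2 * s) := by
    rw [hsin, hτs, cis_add, hI, two_mul, cis_add]
    linear_combination (-cis s * (cis s - cis (-s))) * Complex.I_mul_I - cis_mul_cis_neg s
  have e2 : 1 - cis (-τ) * (-((2 * Real.sin s : ℝ) : ℂ)) = cis (-(2 * s)) := by
    rw [hsin, hτs, neg_add, cis_add, hI2, two_mul, neg_add, cis_add]
    linear_combination (cis (-s) * (cis s - cis (-s))) * Complex.I_mul_I - cis_mul_cis_neg s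
  have hpow : ∀ u : ℝ, u ∈ Set.Ioc (-Real.pi) Real.pi → cis u ^ (ν : ℂ) = cis (ν * u) := by
    intro u hu
    rw [Complex.cpow_def_of_ne_zero (cis_ne_zero u), cis, Complex.log_exp (by simpa using hu.1)
      (by simpa using hu.2), cis]
    congr 1
    push_cast; ring
  have hmul : ν * -(2 * s) = -β := by rw [mul_neg, hνs]
  rw [segMap, segPow, segPow, e1, e2, hpow _ ⟨by linarith, by linarith⟩,
    hpow _ ⟨by linarith, by linarith⟩, hνs, hmul, mul_comm, sub_self, zero_div]

end IsSegmentData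

/-! ### The convergence rate and the Faber polynomials of the segment. -/

/-- The exterior angle of the segment at each corner is `2π - β`, which must equal `ν π`; `τ` is
then fixed by letting one boundary arc of the disc go to the chord. -/
theorem isSegmentData {β : ℝ} (hβ : β ∈ Set.Ioo 0 (Real.pi / 2)) :
    IsSegmentData β (2 - β / Real.pi) (Real.pi / (2 - β / Real.pi)) := by
  have hπ := Real.pi_pos
  have h1 : β / Real.pi < 1 / 2 := by
    rw [div_lt_iff₀ hπ]; linarith [hβ.2]
  have h2 : 0 < β / Real.pi := div_pos hβ.1 hπ
  have hν : 1 < 2 - β / Real.pi := by linarith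
  have hν0 : 0 < 2 - β / Real.pi := by linarith
  refine ⟨hβ, hν, ⟨by positivity, ?_⟩, by rw [mul_comm, div_mul_cancel₀ _ hν0.ne'],
    by field_simp⟩
  rw [div_lt_iff₀ hν0]
  nlinarith

theorem gammaRate_eq (β : ℝ) :
    gammaRate β = 2 * Real.sin (β / (2 * (2 - β / Real.pi))) := by
  rw [gammaRate]
  congr 3
  ring

theorem gammaRate_mem {β : ℝ} (hβ : β ∈ Set.Ioo 0 (Real.pi / 2)) :
    gammaRate β ∈ Set.Ioo 0 1 := by
  have hπ := Real.pi_pos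
  have h1 : β / Real.pi < 1 / 2 := by
    rw [div_lt_iff₀ hπ]; linarith [hβ.2]
  have h2 : 0 < β / Real.pi := div_pos hβ.1 hπ
  have hν0 : 0 < 2 * (2 - β / Real.pi) := by linarith
  have hs0 : 0 < β / (2 * (2 - β / Real.pi)) := div_pos hβ.1 hν0
  -- For `β < π/2` the denominator exceeds `3`, and `2 sin (π/6) = 1`.
  have hs1 : β / (2 * (2 - β / Real.pi)) < Real.pi / 6 := by
    rw [div_lt_iff₀ hν0]
    have : Real.pi * (β / Real.pi) = β := by field_simp
    nlinarith [hβ.2]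
  rw [gammaRate_eq]
  refine ⟨mul_pos two_pos (Real.sin_pos_of_pos_of_lt_pi hs0 (by linarith)), ?_⟩
  have := Real.sin_lt_sin_of_lt_of_le_pi_div_two (by linarith) (by linarith) hs1
  rw [Real.sin_pi_div_six] at this
  linarith

open Polynomial in
/-- Faber polynomials of a circular segment. -/
theorem exists_polynomial_circSegment {β : ℝ} (hβ : β ∈ Set.Ioo 0 (Real.pi / 2)) {n : ℕ}
    (hn : n ≠ 0) :
    ∃ p : ℂ[X], p.natDegree ≤ n ∧ (∀ z ∈ circSegment β, ‖p.eval z‖ ≤ 2) ∧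
      (gammaRate β ^ n)⁻¹ - 3 ≤ ‖p.eval 0‖ := by
  have h := isSegmentData hβ
  obtain ⟨hγ0, hγ1⟩ := gammaRate_mem hβ
  have hnorm : ‖(-(gammaRate β : ℝ) : ℂ)‖ = gammaRate β := by
    rw [norm_neg, Complex.norm_real, Real.norm_of_nonneg hγ0.le]
  have hχ := h.segMap_eq_zero
  rw [← gammaRate_eq] at hχ
  have := exists_faber_polynomial (Z := circSegment β) h.segMap_diffContOnCl
    h.segDeriv_diffContOnCl h.segMap_zero_ne_zero h.segDeriv_zero
    (fun ζ hζ h0 => h.segMap_div_hasDerivAt (by simpa using hζ) h0)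
    (fun z hz ζ hζ => h.segMap_sub_ne_zero (by simpa using hζ) hz)
    (fun z hz ζ hζ => h.re_segDeriv_div_nonneg (by simpa using hζ) hz)
    (fun ζ hζ => h.segMap_div_mem_closure (by simpa using hζ)) hn
    (ζ₀ := (-(gammaRate β : ℝ) : ℂ)) (by rw [mem_ball_zero_iff, hnorm]; exact hγ1)
    (by rw [← norm_ne_zero_iff, hnorm]; exact hγ0.ne') hχ
  rwa [hnorm] at this

/-! ### Spectral decomposition and eigenvalue condition numbers. -/

theorem Matrix.mem_spectrum_iff_charpoly_isRoot {n : ℕ} (B : Matrix (Fin n) (Fin n) ℂ) (μ : ℂ) :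
    μ ∈ spectrum ℂ B ↔ B.charpoly.IsRoot μ := by
  rw [spectrum.mem_iff, Matrix.isUnit_iff_isUnit_det, isUnit_iff_ne_zero, not_not,
    Polynomial.IsRoot.def, Matrix.eval_charpoly]
  rfl

theorem mulVec_eq_smul_iff {n : ℕ} (B : Matrix (Fin n) (Fin n) ℂ) (μ : ℂ)
    (u : EuclideanSpace ℂ (Fin n)) :
    Matrix.mulVec B u.ofLp = μ • u.ofLp ↔ euclOp B u = μ • u := by
  rw [← (WithLp.ofLp_injective 2).eq_iff]
  rfl

theorem vecMul_star_eq_smul_iff {n : ℕ} (B : Matrix (Fin n) (Fin n) ℂ) (μ : ℂ)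
    (v : EuclideanSpace ℂ (Fin n)) :
    Matrix.vecMul (star v.ofLp) B = μ • star v.ofLp ↔
      ∀ x, inner ℂ v (euclOp B x) = μ * inner ℂ v x := by
  have h1 : ∀ x : EuclideanSpace ℂ (Fin n),
      inner ℂ v (euclOp B x) = Matrix.vecMul (star v.ofLp) B ⬝ᵥ x.ofLp := by
    intro x
    rw [EuclideanSpace.inner_eq_star_dotProduct, Matrix.ofLp_toEuclideanCLM, dotProduct_comm,
      Matrix.dotProduct_mulVec]
  have h2 : ∀ x : EuclideanSpace ℂ (Fin n),
      μ * inner ℂ v x = (μ • star v.ofLp) ⬝ᵥ x.ofLp := by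
    intro x
    rw [EuclideanSpace.inner_eq_star_dotProduct, dotProduct_comm, smul_dotProduct, smul_eq_mul]
  simp_rw [h1, h2]
  constructor
  · intro h x; rw [h]
  · intro h
    exact dotProduct_eq _ _ fun x => h (WithLp.toLp 2 x)

/-- Biorthogonal systems of right eigenvectors `u` and left eigenvectors `w` of `B`, belonging to
the distinct eigenvalues `μ`. -/
structure IsEigensystem {n : ℕ} (B : Matrix (Fin n) (Fin n) ℂ) (μ : Fin n → ℂ)
    (u w : Fin n → EuclideanSpace ℂ (Fin n)) : Prop where
  injective : Function.Injective μ
  range_eq : Set.range μ = spectrum ℂ B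
  apply_right : ∀ i, euclOp B (u i) = μ i • u i
  inner_left : ∀ i x, inner ℂ (w i) (euclOp B x) = μ i * inner ℂ (w i) x
  inner_eq : ∀ i j, inner ℂ (w i) (u j) = if i = j then 1 else 0
  sum_eq : ∀ x, ∑ i, inner ℂ (w i) x • u i = x

/-- Simple roots give `n` distinct eigenvalues, hence a basis of eigenvectors. The left eigenvectors
are the Riesz representatives of its coordinate functionals. -/
theorem exists_isEigensystem {n : ℕ} (B : Matrix (Fin n) (Fin n) ℂ)
    (hsimple : ∀ μ ∈ spectrum ℂ B, B.charpoly.rootMultiplicity μ = 1) :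
    ∃ μ u w, IsEigensystem B μ u w := by
  have hnodup : B.charpoly.roots.Nodup := by
    rw [Multiset.nodup_iff_count_le_one]
    intro a
    rw [Polynomial.count_roots]
    by_cases ha : a ∈ spectrum ℂ B
    · exact (hsimple a ha).le
    · rw [Polynomial.rootMultiplicity_eq_zero
        (fun h => ha ((B.mem_spectrum_iff_charpoly_isRoot a).2 h))]
      exact zero_le_one
  have hcard : B.charpoly.roots.toFinset.card = n := by
    rw [Multiset.toFinset_card_of_nodup hnodup, IsAlgClosed.card_roots_eq_natDegree,
      Matrix.charpoly_natDegree_eq_dim, Fintype.card_fin]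
  set e := (B.charpoly.roots.toFinset.equivFinOfCardEq hcard).symm
  set μ : Fin n → ℂ := fun i => (e i : ℂ) with hμ
  have hinj : Function.Injective μ := Subtype.val_injective.comp e.injective
  have hrange : Set.range μ = spectrum ℂ B := by
    ext z
    rw [B.mem_spectrum_iff_charpoly_isRoot, ← Polynomial.mem_roots B.charpoly_monic.ne_zero,
      ← Multiset.mem_toFinset]
    constructor
    · rintro ⟨i, rfl⟩
      exact (e i).2
    · intro hz
      exact ⟨e.symm ⟨z, hz⟩, by simp [hμ]⟩
  have hex : ∀ i, ∃ u : EuclideanSpace ℂ (Fin n), u ≠ 0 ∧ euclOp B u = μ i • u := by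
    intro i
    have h1 : μ i ∈ spectrum ℂ B := hrange ▸ ⟨i, rfl⟩
    rw [B.mem_spectrum_iff_charpoly_isRoot, Polynomial.IsRoot.def, Matrix.eval_charpoly,
      ← Matrix.exists_mulVec_eq_zero_iff] at h1
    obtain ⟨v, hv, h2⟩ := h1
    refine ⟨WithLp.toLp 2 v, by simpa using hv, ?_⟩
    rw [← mulVec_eq_smul_iff]
    rw [Matrix.sub_mulVec, sub_eq_zero, Matrix.scalar_apply, ← Matrix.smul_one_eq_diagonal,
      Matrix.smul_mulVec, Matrix.one_mulVec] at h2
    exact h2.symm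
  choose u hu0 hu using hex
  have hli : LinearIndependent ℂ u :=
    Module.End.eigenvectors_linearIndependent' (euclOp B).toLinearMap μ hinj u fun i =>
      ⟨Module.End.mem_eigenspace_iff.2 (hu i), hu0 i⟩
  have hfin : Fintype.card (Fin n) = Module.finrank ℂ (EuclideanSpace ℂ (Fin n)) := by simp
  set b := basisOfLinearIndependentOfCardEqFinrank' u hli hfin with hb
  have hbu : ∀ i, b i = u i := fun i => by simp [hb]
  set w : Fin n → EuclideanSpace ℂ (Fin n) := fun i =>
    (InnerProductSpace.toDual ℂ _).symm (LinearMap.toContinuousLinearMap (b.coord i)) with hw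
  have hwx : ∀ i x, inner ℂ (w i) x = b.coord i x := fun i x => by
    simp [hw, InnerProductSpace.toDual_symm_apply]
  have hsum : ∀ x, ∑ i, inner ℂ (w i) x • u i = x := by
    intro x
    simp_rw [hwx, ← hbu]
    exact b.sum_repr x
  have heq : ∀ i j, inner ℂ (w i) (u j) = if i = j then (1 : ℂ) else 0 := by
    intro i j
    rw [hwx, ← hbu, b.coord_apply, b.repr_self, Finsupp.single_apply]
    simp only [eq_comm]
  refine ⟨μ, u, w, hinj, hrange, hu, fun i x => ?_, heq, hsum⟩
  conv_lhs => rw [← hsum x]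
  simp_rw [map_sum, map_smul, hu, inner_sum, inner_smul_right, heq]
  simp [mul_comm]

namespace IsEigensystem

variable {n : ℕ} {B : Matrix (Fin n) (Fin n) ℂ} {μ : Fin n → ℂ}
  {u w : Fin n → EuclideanSpace ℂ (Fin n)}

theorem right_ne_zero (h : IsEigensystem B μ u w) (i : Fin n) : u i ≠ 0 := by
  intro h0
  have := h.inner_eq i i
  simp [h0] at this

theorem left_ne_zero (h : IsEigensystem B μ u w) (i : Fin n) : w i ≠ 0 := by
  intro h0
  have := h.inner_eq i i
  simp [h0] at this

theorem eq_smul_right (h : IsEigensystem B μ u w) {i : Fin n} {x : EuclideanSpace ℂ (Fin n)}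
    (hx : euclOp B x = μ i • x) : x = inner ℂ (w i) x • u i := by
  conv_lhs => rw [← h.sum_eq x]
  refine Finset.sum_eq_single i (fun j _ hj => ?_) (by simp)
  have h1 := h.inner_left j x
  rw [hx, inner_smul_right] at h1
  have h2 : (μ i - μ j) * inner ℂ (w j) x = 0 := by rw [sub_mul, h1, sub_self]
  have h3 : μ i - μ j ≠ 0 := sub_ne_zero.2 fun h4 => hj (h.injective h4).symm
  rw [(mul_eq_zero.1 h2).resolve_left h3, zero_smul]

theorem eq_smul_left (h : IsEigensystem B μ u w) {i : Fin n} {v : EuclideanSpace ℂ (Fin n)}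
    (hv : ∀ x, inner ℂ v (euclOp B x) = μ i * inner ℂ v x) :
    v = (starRingEnd ℂ) (inner ℂ v (u i)) • w i := by
  refine ext_inner_right ℂ fun x => ?_
  rw [inner_smul_left, Complex.conj_conj]
  conv_lhs => rw [← h.sum_eq x]
  rw [inner_sum, Finset.sum_eq_single i, inner_smul_right, mul_comm]
  · intro j _ hj
    have h1 := hv (u j)
    rw [h.apply_right, inner_smul_right] at h1
    have h2 : (μ j - μ i) * inner ℂ v (u j) = 0 := by rw [sub_mul, h1, sub_self]
    have h3 : μ j - μ i ≠ 0 := sub_ne_zero.2 fun h4 => hj (h.injective h4)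
    rw [inner_smul_right, (mul_eq_zero.1 h2).resolve_left h3, mul_zero]
  · simp

/-- Both eigenspaces are lines and the quotient is invariant under scaling, so the supremum is over
a single value; the denominator is `1` by biorthogonality. -/
theorem eigenvalueCond_eq (h : IsEigensystem B μ u w) (i : Fin n) :
    eigenvalueCond B (μ i) = ‖u i‖ * ‖w i‖ := by
  have : {κ : ℝ | ∃ u' v : EuclideanSpace ℂ (Fin n), u' ≠ 0 ∧ v ≠ 0 ∧
      Matrix.mulVec B u'.ofLp = μ i • u'.ofLp ∧
      Matrix.vecMul (star v.ofLp) B = μ i • star v.ofLp ∧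
      κ = ‖u'‖ * ‖v‖ / ‖inner ℂ v u'‖} = {‖u i‖ * ‖w i‖} := by
    ext κ
    simp only [Set.mem_ofPred_eq, Set.mem_singleton_iff, mulVec_eq_smul_iff,
      vecMul_star_eq_smul_iff]
    constructor
    · rintro ⟨x, v, hx, hv, hx', hv', rfl⟩
      obtain ⟨c, e1⟩ : ∃ c : ℂ, x = c • u i := ⟨_, h.eq_smul_right hx'⟩
      obtain ⟨d, e2⟩ : ∃ d : ℂ, v = d • w i := ⟨_, h.eq_smul_left hv'⟩
      have hc : c ≠ 0 := by intro h0; rw [h0, zero_smul] at e1; exact hx e1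
      have hd : d ≠ 0 := by intro h0; rw [h0, zero_smul] at e2; exact hv e2
      have hc' := norm_ne_zero_iff.2 hc
      have hd' := norm_ne_zero_iff.2 hd
      rw [e1, e2, inner_smul_left, inner_smul_right, h.inner_eq, if_pos rfl, mul_one, norm_mul,
        norm_smul, norm_smul, RCLike.norm_conj]
      field_simp
    · rintro rfl
      refine ⟨u i, w i, h.right_ne_zero i, h.left_ne_zero i, h.apply_right i, h.inner_left i, ?_⟩
      simp [h.inner_eq]
  rw [eigenvalueCond, this, csSup_singleton]

theorem cond_le_max (h : IsEigensystem B μ u w) (i : Fin n) :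
    ‖u i‖ * ‖w i‖ ≤ maxEigenvalueCond B := by
  have hfin : Finite (spectrum ℂ B) := by
    rw [← h.range_eq]; infer_instance
  rw [← h.eigenvalueCond_eq]
  exact le_ciSup (f := fun μ : spectrum ℂ B => eigenvalueCond B μ) (Set.finite_range _).bddAbove
    ⟨μ i, h.range_eq ▸ ⟨i, rfl⟩⟩

theorem one_le_cond (h : IsEigensystem B μ u w) (i : Fin n) : 1 ≤ ‖u i‖ * ‖w i‖ := by
  have := norm_inner_le_norm (𝕜 := ℂ) (w i) (u i)
  rwa [h.inner_eq, if_pos rfl, norm_one, mul_comm] at this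

theorem norm_le (h : IsEigensystem B μ u w) (i : Fin n) : ‖μ i‖ ≤ ‖euclOp B‖ := by
  have h1 := (euclOp B).le_opNorm (u i)
  rw [h.apply_right, norm_smul] at h1
  exact le_of_mul_le_mul_right h1 (norm_pos_iff.2 (h.right_ne_zero i))

open Polynomial in
theorem _root_.euclOp_aeval_apply {x : EuclideanSpace ℂ (Fin n)} {c : ℂ} (hx : euclOp B x = c • x)
    (p : ℂ[X]) : euclOp (aeval B p) x = p.eval c • x := by
  have hpow : ∀ j : ℕ, euclOp (B ^ j) x = c ^ j • x := by
    intro j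
    induction j with
    | zero => simp [euclOp]
    | succ j ih =>
      rw [pow_succ', euclOp, map_mul, mul_apply_eq_comp]
      change euclOp B (euclOp (B ^ j) x) = _
      rw [ih, map_smul, hx, smul_smul, pow_succ]
  induction p using Polynomial.induction_on' with
  | add p q hp hq =>
    rw [map_add, euclOp, map_add, _root_.add_apply, eval_add, add_smul, ← hp, ← hq]
  | monomial j a =>
    rw [aeval_monomial, ← Algebra.smul_def, euclOp, map_smul, _root_.smul_apply,
      eval_monomial, mul_smul, ← hpow]

open Polynomial in
/-- A polynomial of `B` is bounded by its values on the spectrum. -/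
theorem norm_aeval_le (h : IsEigensystem B μ u w) (p : ℂ[X]) {C : ℝ}
    (hp : ∀ i, ‖p.eval (μ i)‖ ≤ C) (x : EuclideanSpace ℂ (Fin n)) :
    ‖euclOp (aeval B p) x‖ ≤ n * maxEigenvalueCond B * C * ‖x‖ := by
  conv_lhs => rw [← h.sum_eq x]
  rw [map_sum]
  refine (norm_sum_le_of_le (f := fun i => euclOp (aeval B p) (inner ℂ (w i) x • u i))
    (n := fun _ => maxEigenvalueCond B * C * ‖x‖) Finset.univ fun i _ => ?_).trans_eq ?_
  · rw [map_smul, euclOp_aeval_apply (h.apply_right i), norm_smul, norm_smul]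
    have h1 := norm_inner_le_norm (𝕜 := ℂ) (w i) x
    have h2 := h.cond_le_max i
    have h3 := hp i
    have hC : 0 ≤ C := (norm_nonneg _).trans h3
    calc ‖inner ℂ (w i) x‖ * (‖p.eval (μ i)‖ * ‖u i‖)
        ≤ (‖w i‖ * ‖x‖) * (C * ‖u i‖) := by gcongr
      _ = (‖u i‖ * ‖w i‖) * (C * ‖x‖) := by ring
      _ ≤ maxEigenvalueCond B * (C * ‖x‖) := by gcongr
      _ = _ := by ring
  · simp; ring

end IsEigensystem

/-! ### GMRES optimality and the final estimate. -/

open Polynomial in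
/-- The optimality of the GMRES residual among polynomials normalised at `0`. -/
theorem IsGMRESIterate.norm_residual_le {n : ℕ} {B : Matrix (Fin n) (Fin n) ℂ}
    {b x₀ x : EuclideanSpace ℂ (Fin n)} {m : ℕ} (hx : IsGMRESIterate B b x₀ m x) {p : ℂ[X]}
    (hp : p.natDegree ≤ m) (hp0 : p.eval 0 = 1) :
    ‖linResidual B b x‖ ≤ ‖euclOp (aeval B p) (linResidual B b x₀)‖ := by
  set r := linResidual B b x₀ with hr
  have hmem : euclOp (aeval B p.divX) r ∈ krylov B r m := by
    -- For `m = 0` the Krylov space is zero and `p` is constant, while the degree bound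
    -- `p.divX.natDegree < m` used for `m > 0` fails.
    rcases Nat.eq_zero_or_pos m with rfl | hm
    · have : p.divX = 0 := by
        rw [divX_eq_zero_iff]
        exact eq_C_of_natDegree_le_zero hp
      simp [this, euclOp]
    · have hd : p.divX.natDegree < m := by
        rw [natDegree_divX_eq_natDegree_tsub_one]; omega
      rw [aeval_eq_sum_range' hd, euclOp, map_sum, _root_.sum_apply]
      refine Submodule.sum_mem _ fun j hj => ?_
      rw [map_smul, _root_.smul_apply]
      exact Submodule.smul_mem _ _ (Submodule.subset_span ⟨⟨j, Finset.mem_range.1 hj⟩, rfl⟩)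
  have h1 := hx.2 (x₀ - euclOp (aeval B p.divX) r) (by
    rw [sub_sub_cancel_left]
    exact Submodule.neg_mem _ hmem)
  refine h1.trans_eq ?_
  congr 1
  have h2 : aeval B p = B * aeval B p.divX + 1 := by
    conv_lhs => rw [← X_mul_divX_add p]
    rw [coeff_zero_eq_eval_zero, hp0]
    simp
  rw [h2, linResidual, map_sub, euclOp, euclOp, euclOp, map_add, map_mul, map_one,
    _root_.add_apply, mul_apply_eq_comp, one_apply_eq_self, hr,
    linResidual]
  abel

open Polynomial in
/-- A normalised polynomial that decays geometrically on the scaled circular segment. -/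
theorem exists_normalized_polynomial {β R : ℝ} (hβ : β ∈ Set.Ioo 0 (Real.pi / 2)) (hR : 0 < R)
    {k : ℕ} (hk : k ≠ 0) (hγ : 12 * gammaRate β ^ k < 1) :
    ∃ q : ℂ[X], q.natDegree ≤ k ∧ q.eval 0 = 1 ∧
      ∀ z : ℂ, ‖z‖ < R → R * Real.cos β < z.re → ‖q.eval z‖ ≤ 12 * gammaRate β ^ k := by
  obtain ⟨p, hpk, hp, hp0⟩ := exists_polynomial_circSegment hβ hk
  have hg : 0 < gammaRate β ^ k := pow_pos (gammaRate_mem hβ).1 k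
  set g := gammaRate β ^ k
  have hg12 : 12 < g⁻¹ := by rw [lt_inv_comm₀ (by norm_num) hg]; linarith
  have hp0' : 0 < ‖p.eval 0‖ := by linarith
  have hne : p.eval 0 ≠ 0 := norm_pos_iff.1 hp0'
  refine ⟨C (p.eval 0)⁻¹ * p.comp (C (R⁻¹ : ℂ) * X), ?_, by simp [hne], fun z hz hre => ?_⟩
  · refine natDegree_C_mul_le _ _ |>.trans (natDegree_comp_le.trans ?_)
    exact (Nat.mul_le_mul hpk (natDegree_C_mul_le _ _ |>.trans natDegree_X_le)).trans_eq (mul_one k)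
  · have hmem : (R⁻¹ : ℂ) * z ∈ circSegment β := by
      rw [← Complex.ofReal_inv]
      refine ⟨?_, ?_⟩
      · rw [norm_mul, Complex.norm_real, Real.norm_of_nonneg (by positivity), inv_mul_lt_iff₀ hR]
        linarith
      · rw [Complex.re_ofReal_mul, lt_inv_mul_iff₀ hR]
        exact hre
    have h2 := hp _ hmem
    rw [eval_mul, eval_C, eval_comp, eval_mul, eval_C, eval_X, norm_mul, norm_inv,
      inv_mul_le_iff₀ hp0']
    have h3 : g * g⁻¹ = 1 := mul_inv_cancel₀ hg.ne'
    -- With `g < 1/12`, `2 / (g⁻¹ - 3) ≤ (8/3) g`, well below `12 g`; the constant `12` is what the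
    -- final estimate allows.
    nlinarith [mul_le_mul_of_nonneg_right hp0 hg.le]

open Polynomial in
/-- The deflation polynomial `∏ j, (1 - X / lam j)` has degree at most `ℓ`. -/
theorem natDegree_prod_one_sub_le {ℓ : ℕ} (lam : Fin ℓ → ℂ) :
    (∏ j, (1 - C (lam j)⁻¹ * X : ℂ[X])).natDegree ≤ ℓ := by
  refine (natDegree_prod_le _ _).trans ((Finset.sum_le_card_nsmul _ _ 1 fun j _ => ?_).trans ?_)
  · refine (natDegree_sub_le _ _).trans (max_le (by simp) (natDegree_C_mul_le _ _ |>.trans natDegree_X_le))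
  · simp

theorem theorem1p2 {n : ℕ} (B : Matrix (Fin n) (Fin n) ℂ)
    -- `B` is nonsingular and all its eigenvalues are (algebraically) simple
    (hB : IsUnit B)
    (hsimple : ∀ μ ∈ spectrum ℂ B, B.charpoly.rootMultiplicity μ = 1)
    -- location of the eigenvalues
    (N : Set ℂ) (hNopen : IsOpen N) (hNbdd : Bornology.IsBounded N) (hN0 : (0 : ℂ) ∈ N)
    (S : ℝ) (hS : 0 < S)
    (hspec : spectrum ℂ B ⊆ N ∪ {z : ℂ | S ≤ z.re})
    (hH : (spectrum ℂ B ∩ {z : ℂ | S ≤ z.re}).Nonempty)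
    -- `lam 0, …, lam (ℓ - 1)` are the eigenvalues in `N`
    (ℓ : ℕ) (lam : Fin ℓ → ℂ) (hlam_inj : Function.Injective lam)
    (hlam : Set.range lam = spectrum ℂ B ∩ N)
    (L₀ L₁ : ℝ) (hL₀ : 0 < L₀) (hL : L₀ < L₁) (hL₁ : L₁ ≤ S)
    (Neig : ℕ)
    (hNeig : Neig = {j : Fin ℓ | lam j ∈ {z : ℂ | L₀ < z.re ∧ z.re < L₁} ∩ N}.ncard + 1)
    (δ : ℝ) (hδ : δ = (L₁ - L₀) / (4 * n * maxEigenvalueCond B * Neig)) :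
    S ≤ ‖euclOp B‖ ∧
    ∃ β ∈ Set.Ioo (0 : ℝ) (Real.pi / 2),
      Real.cos β = L₀ / (‖euclOp B‖ + δ) ∧
      gammaRate β < 1 ∧
      ∀ (b x₀ : EuclideanSpace ℂ (Fin n)) (m : ℕ) (xm : EuclideanSpace ℂ (Fin n)),
        linResidual B b x₀ ≠ 0 →
        IsGMRESIterate B b x₀ m xm →
        ‖linResidual B b xm‖ / ‖linResidual B b x₀‖ ≤
          (∏ j : Fin ℓ, 1 / ‖lam j‖) * (‖euclOp B‖ + δ) ^ (ℓ + 1) * 3 ^ (ℓ + 1) * δ⁻¹ *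
            gammaRate β ^ ((m : ℤ) - (ℓ : ℤ)) := by
  obtain ⟨μ, u, w, h⟩ := exists_isEigensystem B hsimple
  obtain ⟨z₀, hz₀, hz₀S⟩ := hH
  obtain ⟨i₀, rfl⟩ : z₀ ∈ Set.range μ := h.range_eq ▸ hz₀
  have hST : S ≤ ‖euclOp B‖ := le_trans hz₀S ((Complex.re_le_norm _).trans (h.norm_le i₀))
  refine ⟨hST, ?_⟩
  set T := ‖euclOp B‖
  have hκ : 1 ≤ maxEigenvalueCond B := (h.one_le_cond i₀).trans (h.cond_le_max i₀)
  set κ := maxEigenvalueCond B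
  have hn : (1 : ℝ) ≤ n := by exact_mod_cast (Nat.zero_le _).trans_lt i₀.2
  have hNe : (1 : ℝ) ≤ Neig := by exact_mod_cast hNeig ▸ Nat.le_add_left 1 _
  have hden : 0 < 4 * n * κ * Neig := by positivity
  have hδ0 : 0 < δ := by rw [hδ]; exact div_pos (by linarith) hden
  -- Since `Neig ≥ 1`, the left side is at most `L₁ - L₀`, which is less than `S ≤ T`. Multiplied by
  -- `3 / δ`, this absorbs the factor `12 n κ`.
  have hδR : 4 * (n * κ) * δ ≤ T + δ := by
    have h1 : δ * (4 * n * κ * Neig) = L₁ - L₀ := by rw [hδ]; field_simp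
    have h2 : 0 ≤ 4 * (n * κ) * δ * (Neig - 1) :=
      mul_nonneg (by positivity) (by linarith)
    nlinarith
  have hnκ : 1 ≤ n * κ := one_le_mul_of_one_le_of_one_le hn hκ
  set R := T + δ with hR
  have hR0 : 0 < R := by linarith
  have hq0 : 0 < L₀ / R := div_pos hL₀ hR0
  have hq1 : L₀ / R < 1 := by rw [div_lt_one hR0]; linarith
  have hβ : Real.arccos (L₀ / R) ∈ Set.Ioo 0 (Real.pi / 2) :=
    ⟨Real.arccos_pos.2 hq1, Real.arccos_lt_pi_div_two.2 hq0⟩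
  have hcos : Real.cos (Real.arccos (L₀ / R)) = L₀ / R :=
    Real.cos_arccos (by linarith) hq1.le
  refine ⟨_, hβ, hcos, (gammaRate_mem hβ).2, ?_⟩
  generalize Real.arccos (L₀ / R) = β at hβ hcos
  obtain ⟨hγ0, hγ1⟩ := gammaRate_mem hβ
  intro b x₀ m xm hr hx
  have hr0 : 0 < ‖linResidual B b x₀‖ := norm_pos_iff.2 hr
  have hlamspec : ∀ j, lam j ∈ spectrum ℂ B := fun j => (hlam ▸ ⟨j, rfl⟩ : lam j ∈ _ ∩ N).1
  have hlam0 : ∀ j, lam j ≠ 0 := fun j h0 =>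
    spectrum.zero_notMem ℂ hB (h0 ▸ hlamspec j)
  have hlamR : ∀ j, ‖lam j‖ < R := by
    intro j
    obtain ⟨i, hi⟩ : lam j ∈ Set.range μ := h.range_eq ▸ hlamspec j
    rw [← hi]
    linarith [h.norm_le i]
  have hrhs : (∏ j : Fin ℓ, 1 / ‖lam j‖) * R ^ (ℓ + 1) * 3 ^ (ℓ + 1) * δ⁻¹ *
      gammaRate β ^ ((m : ℤ) - (ℓ : ℤ)) =
      (∏ j : Fin ℓ, 3 * R / ‖lam j‖) * (3 * R / δ * gammaRate β ^ ((m : ℤ) - (ℓ : ℤ))) := by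
    have : ∏ j : Fin ℓ, 3 * R / ‖lam j‖ = (3 * R) ^ ℓ * ∏ j : Fin ℓ, 1 / ‖lam j‖ := by
      simp [div_eq_mul_inv, Finset.prod_mul_distrib]
    rw [this, mul_pow]
    ring
  have hG1 : 1 ≤ ∏ j : Fin ℓ, 3 * R / ‖lam j‖ := by
    refine Finset.prod_const_one.symm.trans_le
      (Finset.prod_le_prod (fun _ _ => zero_le_one) fun j _ => ?_)
    rw [one_le_div (norm_pos_iff.2 (hlam0 j))]
    linarith [hlamR j]
  have hRδ : 12 * (n * κ) ≤ 3 * R / δ := by rw [le_div_iff₀ hδ0]; linarith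
  have hγk : 0 < gammaRate β ^ ((m : ℤ) - (ℓ : ℤ)) := zpow_pos hγ0 _
  rw [hrhs, div_le_iff₀ hr0]
  set G := ∏ j : Fin ℓ, 3 * R / ‖lam j‖ with hG
  -- If `12 γ ^ (m - ℓ) ≥ 1`, the right-hand side is at least `‖r₀‖` and `p = 1` suffices. Otherwise
  -- `m > ℓ`, and degree `m - ℓ` is left for `q`.
  rcases le_or_gt 1 (12 * gammaRate β ^ ((m : ℤ) - (ℓ : ℤ))) with hc | hc
  · have h1 := hx.norm_residual_le (p := 1) (by simp) (by simp)
    rw [map_one, euclOp, map_one, one_apply_eq_self] at h1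
    refine h1.trans (le_mul_of_one_le_left hr0.le (one_le_mul_of_one_le_of_one_le hG1 ?_))
    refine hc.trans (mul_le_mul_of_nonneg_right ?_ hγk.le)
    linarith
  · have hlt : ℓ < m := by
      by_contra! hle
      have := one_le_zpow_of_nonpos₀ hγ0 hγ1.le (n := (m : ℤ) - ℓ) (by omega)
      linarith
    obtain ⟨k, rfl⟩ := Nat.exists_eq_add_of_lt hlt
    have hexp : ((ℓ + k + 1 : ℕ) : ℤ) - (ℓ : ℤ) = ((k + 1 : ℕ) : ℤ) := by push_cast; ring
    rw [hexp, zpow_natCast] at hc hγk ⊢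
    obtain ⟨q, hqk, hq0, hq⟩ := exists_normalized_polynomial hβ hR0 k.succ_ne_zero hc
    set d : Polynomial ℂ := ∏ j, (1 - Polynomial.C (lam j)⁻¹ * Polynomial.X) with hd
    have hP : ∀ i, ‖(d * q).eval (μ i)‖ ≤ G * (12 * gammaRate β ^ (k + 1)) := by
      intro i
      rw [Polynomial.eval_mul, hd, Polynomial.eval_prod]
      have hi : μ i ∈ spectrum ℂ B := h.range_eq ▸ ⟨i, rfl⟩
      by_cases hN : μ i ∈ N
      · obtain ⟨j, hj⟩ : μ i ∈ Set.range lam := hlam ▸ ⟨hi, hN⟩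
        rw [Finset.prod_eq_zero (Finset.mem_univ j) (by simp [← hj, hlam0 j]), zero_mul, norm_zero]
        positivity
      · have hre : S ≤ (μ i).re := (hspec hi).resolve_left hN
        rw [norm_mul, norm_prod]
        -- Here `|λⱼ - μᵢ| ≤ 2R ≤ 3R`, and `μᵢ` lies in the scaled segment because `|μᵢ| ≤ T < R`
        -- and `R cos β = L₀ < S`.
        refine mul_le_mul (Finset.prod_le_prod (fun j _ => norm_nonneg _) fun j _ => ?_)
          (hq _ ?_ ?_) (norm_nonneg _) (by positivity)
        · have e1 : Polynomial.eval (μ i) (1 - Polynomial.C (lam j)⁻¹ * Polynomial.X) =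
              (lam j - μ i) / lam j := by
            have := hlam0 j
            simp
            field_simp
          rw [e1, norm_div]
          gcongr
          refine (norm_sub_le _ _).trans ?_
          linarith [hlamR j, h.norm_le i]
        · linarith [h.norm_le i]
        · rw [hcos, mul_div_cancel₀ _ hR0.ne']
          linarith
    have h1 := hx.norm_residual_le (p := d * q) (Polynomial.natDegree_mul_le.trans
      (add_le_add (natDegree_prod_one_sub_le lam) hqk : _ ≤ ℓ + (k + 1))) (by
        rw [Polynomial.eval_mul, hq0, hd, Polynomial.eval_prod]; simp)
    refine h1.trans ((h.norm_aeval_le _ hP _).trans (mul_le_mul_of_nonneg_right ?_ hr0.le))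
    calc n * κ * (G * (12 * gammaRate β ^ (k + 1)))
        = 12 * (n * κ) * (G * gammaRate β ^ (k + 1)) := by ring
      _ ≤ 3 * R / δ * (G * gammaRate β ^ (k + 1)) := by gcongr
      _ = _ := by ring
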